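/- Consider the force-free equilibrium system $\operatorname{curl}\mathbf B=\alpha(\mathbf x)\,\mathbf B$, $\operatorname{div}\mathbf B=0$ for a vector field $\mathbf B=(A,B,C)$ of $\mathbf x=(x,y,z)\in\mathbb R^3$, where the function $\alpha(\mathbf x)$ is not prescribed (and so may change under transformations). Let $p^k_i=\partial B^k/\partial x^i$ and consider infinitesimal operators $$X=\sum_i\xi^i\frac{\partial}{\partial x^i}+\sum_k\eta^k\frac{\partial}{\partial B^k},\qquad \xi^i=\xi^i(\mathbf x,\mathbf B,p),\quad \eta^k=\eta^k(\mathbf x,\mathbf B,p),$$ whose coefficients may depend on first derivatives; they are assumed smooth over all $(\mathbf x,\mathbf B,p)$ with $\mathbf x\in D$, $\mathbf B\neq0$, where $D\subseteq\mathbb R^3$ is open, connected and nonempty. Let $X_1=X+\sum_{i,k}\zeta^k_i\,\partial/\partial p^k_i$, $\zeta^k_i=D_i\eta^k-\sum_m p^k_mD_i\xi^m$, be the first prolongation ($D_i$ is the total derivative). Write $E$ for the left-hand sides $(\operatorname{curl}\mathbf B-\alpha\mathbf B,\ \operatorname{div}\mathbf B)$ as functions of $(\alpha,\mathbf x,\mathbf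 B,p)$. The operator $X$ is *admitted* if $X_1E=0$ whenever $E=0$ (with arbitrary second derivatives of $\mathbf B$), for a suitable variation of the value of $\alpha$. It is *admitted modulo differential consequences* if the same is required only for those second derivatives that satisfy also $D_jE=0$, $j=1,2,3$, for some values of $\partial\alpha/\partial x^j$. Let $$\begin{aligned}X_{l,R,\alpha,\delta,\gamma,\mu}={}&l_1\partial_x+l_2\partial_y+l_3\partial_z+R\,(x\partial_x+y\partial_y+z\partial_z)+\alpha\,(A\partial_A+B\partial_B+C\partial_C)\\&+\delta\,(y\partial_x-x\partial_y+B\partial_A-A\partial_B)+\gamma\,(z\partial_x-x\partial_z+C\partial_A-A\partial_C)+\mu\,(z\partial_y-y\partial_z+C\partial_B-B\partial_C)\end{aligned}$$ with real constants $l_1,l_2,l_3,R,\alpha,\delta,\gamma,\mu$ (translations, a space scaling, a scaling of $\mathbf B$, and simultaneous rotations of space and field); its coefficients do not depend on derivatives. Then: 1. Every $X_{l,R,\alpha,\delta,\gamma,\mu}$ is admitted (at all $(\mathbf x,\mathbf B,p)$, including $\mathbf B=0$). 2. Every admitted operator $X$ coincides with some $X_{l,R,\alpha,\delta,\gamma,\mu}$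 at all $(\mathbf x,\mathbf B,p)$ that satisfy the system, $\mathbf x\in D$, $\mathbf B\ne0$; in particular, on the system, it does not depend on derivatives. 3. An operator $X$ is admitted modulo differential consequences if and only if, at all $(\mathbf x,\mathbf B,p)$ that satisfy the system, $\mathbf x\in D$, $\mathbf B\ne0$, its characteristic $Q^k=\eta^k-\sum_mp^k_m\xi^m$ equals that of some $X_{l,R,\alpha,\delta,\gamma,\mu}$; that is, up to operators whose characteristic vanishes on the system, nothing new arises. 4. $X_{l,R,\alpha,\delta,\gamma,\mu}$ is obtained from the operator $$X_{l,R,\alpha,\delta,\gamma,\mu}+\beta\,\partial_P+2\alpha P\,\partial_P$$ of the plasma equilibrium equations $\operatorname{curl}\mathbf B\times\mathbf B=\operatorname{grad}P$, $\operatorname{div}\mathbf B=0$ by omitting the pressure terms. -/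

import Mathlib

open scoped ContDiff

/-- Vectors of `ℝ³`, in coordinates. -/
abbrev Vec3 : Type := Fin 3 → ℝ

/-- First-order jets `(x, B, p)`: the point `x`, the value `B = (A, B, C)` of the magnetic field and
its first derivatives `p k i = ∂Bᵏ/∂xⁱ`, all regarded as independent coordinates. -/
abbrev Jet1 : Type := Vec3 × Vec3 × (Fin 3 → Fin 3 → ℝ)

/-- The curl of a field whose Jacobian matrix is `p`, `p k i = ∂Bᵏ/∂xⁱ`. -/
def curlOf (p : Fin 3 → Fin 3 → ℝ) : Vec3 :=
  ![p 2 1 - p 1 2, p 0 2 - p 2 0, p 1 0 - p 0 1]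

/-- The divergence of a field whose Jacobian matrix is `p`. -/
def divOf (p : Fin 3 → Fin 3 → ℝ) : ℝ := ∑ i, p i i

/-- The left-hand sides `(curl B - α B, div B)` of the force-free system, as a function of the value
`α = α(x)` of the (not prescribed) coefficient and of the 1-jet of `B`. -/
def forceFreeLHS (y : ℝ × Jet1) : Vec3 × ℝ :=
  (curlOf y.2.2.2 - y.1 • y.2.2.1, divOf y.2.2.2)

/-- The 1-jets on the force-free system: `curl B = α B`, `div B = 0` for some value `α`. -/
def OnShell (z : Jet1) : Prop := ∃ a : ℝ, forceFreeLHS (a, z) = 0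

/-- An infinitesimal operator `X = ∑ ξⁱ ∂/∂xⁱ + ∑ ηᵏ ∂/∂Bᵏ` whose coefficients may depend on `x`, on
`B` and on the first derivatives of `B`; `(X z).1 = ξ` and `(X z).2 = η`. -/
abbrev Generator : Type := Jet1 → Vec3 × Vec3

/-- The direction in 1-jet space along which the total derivative `Dᵢ` differentiates:
`Dᵢ = ∂/∂xⁱ + pᵏᵢ ∂/∂Bᵏ + wᵏᵢⱼ ∂/∂pᵏⱼ`, where `w k i j = ∂²Bᵏ/∂xⁱ∂xʲ`. -/
def totalDir (z : Jet1) (w : Fin 3 → Fin 3 → Fin 3 → ℝ) (i : Fin 3) : Jet1 :=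
  (Pi.single i 1, fun k => z.2.2 k i, fun k j => w k i j)

/-- The coefficients at `∂/∂pᵏᵢ` of the first prolongation of `X`:
`Dᵢ ηᵏ - ∑ₘ pᵏₘ Dᵢ ξᵐ`. They depend on the second derivatives `w`. -/
noncomputable def prolongCoeff (X : Generator) (z : Jet1) (w : Fin 3 → Fin 3 → Fin 3 → ℝ) :
    Fin 3 → Fin 3 → ℝ :=
  fun k i => (fderiv ℝ X z (totalDir z w i)).2 k
    - ∑ m, z.2.2 k m * (fderiv ℝ X z (totalDir z w i)).1 m

/-- The prolonged operator `X₁`, applied to the left-hand sides of the force-free system at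
`(a, z)`; the coefficient `α` is varied by the amount `b`. -/
noncomputable def prolongedAction (X : Generator) (a b : ℝ) (z : Jet1)
    (w : Fin 3 → Fin 3 → Fin 3 → ℝ) : Vec3 × ℝ :=
  fderiv ℝ forceFreeLHS (a, z) (b, (X z).1, (X z).2, prolongCoeff X z w)

/-- Second derivatives are symmetric. -/
def IsSecondJet (w : Fin 3 → Fin 3 → Fin 3 → ℝ) : Prop := ∀ k i j, w k i j = w k j i

/-- The determining equations `X₁ E = 0` restricted to `E = 0`, over the set `S` of 1-jets: the
equations `E = 0` are imposed on the 1-jet, and the second derivatives that enter through the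
prolongation are independent variables. Since `α(x)` is not prescribed, it may be transformed along
with `x` and `B`: some variation `b` of its value has to make `X₁ E` vanish. -/
def Admits (S : Set Jet1) (X : Generator) : Prop :=
  ∀ z ∈ S, ∀ w, IsSecondJet w → ∀ a : ℝ, forceFreeLHS (a, z) = 0 →
    ∃ b : ℝ, prolongedAction X a b z w = 0

/-- The same determining equations, imposed only at those second-order jets that satisfy the system
together with its first differential consequences `Dⱼ E = 0`; here `da j` is `∂α/∂xʲ`. -/
def AdmitsModConsequences (S : Set Jet1) (X : Generator) : Prop :=
  ∀ z ∈ S, ∀ w, IsSecondJet w → ∀ (a : ℝ) (da : Vec3), forceFreeLHS (a, z) = 0 →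
    (∀ j, fderiv ℝ forceFreeLHS (a, z) (da j, totalDir z w j) = 0) →
    ∃ b : ℝ, prolongedAction X a b z w = 0

/-- The characteristic `Qᵏ = ηᵏ - ∑ₘ pᵏₘ ξᵐ` of a generator: the coefficients of its evolutionary
representative. -/
def characteristic (X : Generator) (z : Jet1) : Vec3 :=
  fun k => (X z).2 k - ∑ m, z.2.2 k m * (X z).1 m

/-- The 1-jets over a set `D` of points of space at which the magnetic field does not vanish. -/
def jetsOver (D : Set Vec3) : Set Jet1 := {z | z.1 ∈ D ∧ z.2.1 ≠ 0}

/-- Coefficients `(ξ, η)` that are functions of `(x, B)` alone. -/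
abbrev PointField : Type := Vec3 × Vec3 → Vec3 × Vec3

/-- A point field, as a generator whose coefficients do not depend on derivatives. -/
def PointField.toGenerator (V : PointField) : Generator := fun z => V (z.1, z.2.1)

/-- `l₁ ∂/∂x + l₂ ∂/∂y + l₃ ∂/∂z` -/
def translationField (l : Vec3) : PointField := fun _ => (l, 0)

/-- `x ∂/∂x + y ∂/∂y + z ∂/∂z` -/
def spaceScaling : PointField := fun q => (q.1, 0)

/-- `A ∂/∂A + B ∂/∂B + C ∂/∂C` -/
def fieldScaling : PointField := fun q => (0, q.2)

/-- `y ∂/∂x - x ∂/∂y + B ∂/∂A - A ∂/∂B` -/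
def rotationXY : PointField := fun q => (![q.1 1, -q.1 0, 0], ![q.2 1, -q.2 0, 0])

/-- `z ∂/∂x - x ∂/∂z + C ∂/∂A - A ∂/∂C` -/
def rotationXZ : PointField := fun q => (![q.1 2, 0, -q.1 0], ![q.2 2, 0, -q.2 0])

/-- `z ∂/∂y - y ∂/∂z + C ∂/∂B - B ∂/∂C` -/
def rotationYZ : PointField := fun q => (![0, q.1 2, -q.1 1], ![0, q.2 2, -q.2 1])

/-- The infinitesimal operator found for the force-free system. -/
def forceFreeOperator (l : Vec3) (R α δ γ μ : ℝ) : PointField :=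
  translationField l + R • spaceScaling + α • fieldScaling
    + δ • rotationXY + γ • rotationXZ + μ • rotationYZ

/-- The infinitesimal operator of the plasma equilibrium equations
`curl B × B = grad P`, `div B = 0`, on the space of `(x, B, P)`; the three components of the value
are the coefficients at `∂/∂x`, at `∂/∂B` and at `∂/∂P`. -/
def plasmaOperator (l : Vec3) (β R α δ γ μ : ℝ) (q : Vec3 × Vec3 × ℝ) : Vec3 × Vec3 × ℝ :=
  (![l 0 + R * q.1 0 + δ * q.1 1 + γ * q.1 2,
     l 1 + R * q.1 1 - δ * q.1 0 + μ * q.1 2,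
     l 2 + R * q.1 2 - γ * q.1 0 - μ * q.1 1],
   ![α * q.2.1 0 + δ * q.2.1 1 + γ * q.2.1 2,
     α * q.2.1 1 - δ * q.2.1 0 + μ * q.2.1 2,
     α * q.2.1 2 - γ * q.2.1 0 - μ * q.2.1 1],
   β + 2 * α * q.2.2)

/-! Modulo differential consequences, the determining equations see an operator only through its
characteristic Q on the shell E = 0. They say that the matrix DQ of total derivatives satisfies curl
DQ = αQ + bB and div DQ = 0 (`exists_prolongedAction_eq_zero_iff`), and they involve only
derivatives of Q tangent to the shell (`fderiv_eq_of_eq_onShell`).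

The shell is parametrised by (α, x, B) and a symmetric trace-free matrix s, and
`exists_symmetric_of_curl` supplies the second jets over it. Adding totally symmetric trace-free
tensors to a second jet forces the s-derivative of Q to be s' ↦ -s'ξ (`exists_eq_symMat_of_linear`).
Integrability in s then makes ξ independent of s (`eq_of_fderiv_eq_symMat`), so Q = η - pξ with
coefficients depending on (α, x, B) only. Varying grad α in the plane orthogonal to B removes α
(`exists_pointField`), and a point field remains.

For a point field the equations are polynomial in p. The quadratic part gives ∂ξ/∂B = 0. The linear
part makes ∂ξ/∂x and ∂η/∂B infinitesimal similarities with a common rotation vector v, and η = cB +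
v × B. Integrating in B makes η linear in B. The terms free of p then make the scaling of B constant
and leave v too rigid for special conformal maps, so ξ is an affine similarity.

When the second derivatives are unrestricted, an admitted operator and the family member with the
same characteristic must also agree in ξ (`eq_zero_of_unrestricted`), hence coincide on the shell.
-/

/-! ### The linearised system; algebra of curl and divergence. -/

theorem fderiv_forceFreeLHS (a : ℝ) (z : Jet1) (b : ℝ) (u β : Vec3) (r : Fin 3 → Fin 3 → ℝ) :
    fderiv ℝ forceFreeLHS (a, z) (b, u, β, r) =
      (curlOf r - (b • z.2.1 + a • β), divOf r) := by
  let pr (k i : Fin 3) : ℝ × Jet1 →L[ℝ] ℝ :=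
    (ContinuousLinearMap.proj (R := ℝ) (φ := fun _ : Fin 3 => ℝ) i).comp
      ((ContinuousLinearMap.proj (R := ℝ) (φ := fun _ : Fin 3 => Fin 3 → ℝ) k).comp
        ((ContinuousLinearMap.snd ℝ Vec3 (Fin 3 → Fin 3 → ℝ)).comp
          ((ContinuousLinearMap.snd ℝ Vec3 (Vec3 × (Fin 3 → Fin 3 → ℝ))).comp
            (ContinuousLinearMap.snd ℝ ℝ Jet1))))
  have hp : ∀ k i : Fin 3, HasFDerivAt (fun y : ℝ × Jet1 => y.2.2.2 k i) (pr k i) (a, z) :=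
    fun k i => (pr k i).hasFDerivAt
  let pB : ℝ × Jet1 →L[ℝ] Vec3 :=
    (ContinuousLinearMap.fst ℝ Vec3 (Fin 3 → Fin 3 → ℝ)).comp
      ((ContinuousLinearMap.snd ℝ Vec3 (Vec3 × (Fin 3 → Fin 3 → ℝ))).comp
        (ContinuousLinearMap.snd ℝ ℝ Jet1))
  have hB : HasFDerivAt (fun y : ℝ × Jet1 => y.2.2.1) pB (a, z) := pB.hasFDerivAt
  have ha : HasFDerivAt (fun y : ℝ × Jet1 => y.1) (ContinuousLinearMap.fst ℝ ℝ Jet1) (a, z) :=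
    hasFDerivAt_fst
  have hc : HasFDerivAt (fun y : ℝ × Jet1 => curlOf y.2.2.2)
      (ContinuousLinearMap.pi ![pr 2 1 - pr 1 2, pr 0 2 - pr 2 0, pr 1 0 - pr 0 1]) (a, z) := by
    refine hasFDerivAt_pi'' fun i => ?_
    fin_cases i
    · exact (hp 2 1).sub (hp 1 2)
    · exact (hp 0 2).sub (hp 2 0)
    · exact (hp 1 0).sub (hp 0 1)
  have hd : HasFDerivAt (fun y : ℝ × Jet1 => divOf y.2.2.2) _ (a, z) :=
    HasFDerivAt.fun_sum fun i _ => hp i i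
  have h := (hc.sub (ha.smul hB)).prodMk hd
  have h' : HasFDerivAt forceFreeLHS _ (a, z) := h
  rw [h'.fderiv]
  refine Prod.ext ?_ ?_
  · ext i
    fin_cases i <;> simp [curlOf, pr, pB] <;> ring
  · simp [divOf, pr]

theorem forceFreeLHS_eq_zero_iff (a : ℝ) (x B : Vec3) (p : Fin 3 → Fin 3 → ℝ) :
    forceFreeLHS (a, x, B, p) = 0 ↔ curlOf p = a • B ∧ divOf p = 0 := by
  simp [forceFreeLHS, Prod.ext_iff, sub_eq_zero]

theorem prolongedAction_eq_zero_iff (X : Generator) (a b : ℝ) (z : Jet1)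
    (w : Fin 3 → Fin 3 → Fin 3 → ℝ) :
    prolongedAction X a b z w = 0 ↔
      curlOf (prolongCoeff X z w) = a • (X z).2 + b • z.2.1 ∧
        divOf (prolongCoeff X z w) = 0 := by
  rw [prolongedAction, fderiv_forceFreeLHS, Prod.ext_iff]
  simp [sub_eq_zero, add_comm]

theorem forceFreeLHS_consequence_iff (a : ℝ) (z : Jet1) (da : ℝ) (u β : Vec3)
    (r : Fin 3 → Fin 3 → ℝ) :
    fderiv ℝ forceFreeLHS (a, z) (da, u, β, r) = 0 ↔
      curlOf r = da • z.2.1 + a • β ∧ divOf r = 0 := by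
  rw [fderiv_forceFreeLHS, Prod.ext_iff]
  simp [sub_eq_zero]

/-- The matrix of `v × ·`. -/
def crossMat (v : Vec3) : Fin 3 → Fin 3 → ℝ :=
  ![![0, -v 2, v 1], ![v 2, 0, -v 0], ![-v 1, v 0, 0]]

theorem curlOf_crossMat (v : Vec3) : curlOf (crossMat v) = (2 : ℝ) • v := by
  ext i; fin_cases i <;> simp [curlOf, crossMat] <;> ring

theorem divOf_crossMat (v : Vec3) : divOf (crossMat v) = 0 := by
  simp [divOf, crossMat, Fin.sum_univ_three]

theorem curlOf_add (p q : Fin 3 → Fin 3 → ℝ) : curlOf (p + q) = curlOf p + curlOf q := by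
  ext i; fin_cases i <;> simp [curlOf] <;> ring

theorem curlOf_smul (c : ℝ) (p : Fin 3 → Fin 3 → ℝ) : curlOf (c • p) = c • curlOf p := by
  ext i; fin_cases i <;> simp [curlOf] <;> ring

theorem divOf_add (p q : Fin 3 → Fin 3 → ℝ) : divOf (p + q) = divOf p + divOf q := by
  simp [divOf, Finset.sum_add_distrib]

theorem divOf_smul (c : ℝ) (p : Fin 3 → Fin 3 → ℝ) : divOf (c • p) = c * divOf p := by
  simp [divOf, Finset.mul_sum]

/-! ### The family of operators, and why it is admitted. -/

/-- `forceFreeOperator` in coordinates. -/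
theorem forceFreeOperator_apply (l : Vec3) (R α δ γ μ : ℝ) (x B : Vec3) :
    forceFreeOperator l R α δ γ μ (x, B) =
      (![l 0 + R * x 0 + δ * x 1 + γ * x 2, l 1 + R * x 1 - δ * x 0 + μ * x 2,
          l 2 + R * x 2 - γ * x 0 - μ * x 1],
        ![α * B 0 + δ * B 1 + γ * B 2, α * B 1 - δ * B 0 + μ * B 2,
          α * B 2 - γ * B 0 - μ * B 1]) := by
  refine Prod.ext ?_ ?_ <;> ext i <;> fin_cases i <;>
    simp [forceFreeOperator, translationField, spaceScaling, fieldScaling, rotationXY, rotationXZ,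
      rotationYZ, Matrix.vecHead, Matrix.vecTail] <;> ring

theorem forceFreeOperator_eq_plasmaOperator (l : Vec3) (β R α δ γ μ : ℝ) (x B : Vec3) (P : ℝ) :
    forceFreeOperator l R α δ γ μ (x, B) =
      ((plasmaOperator l β R α δ γ μ (x, B, P)).1,
        (plasmaOperator l β R α δ γ μ (x, B, P)).2.1) :=
  forceFreeOperator_apply l R α δ γ μ x B

theorem fderiv_forceFreeOperator (l : Vec3) (R α δ γ μ : ℝ) (z v : Jet1) :
    fderiv ℝ (forceFreeOperator l R α δ γ μ).toGenerator z v =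
      forceFreeOperator 0 R α δ γ μ (v.1, v.2.1) := by
  let T : Jet1 →ₗ[ℝ] Vec3 × Vec3 :=
    { toFun := fun v => forceFreeOperator 0 R α δ γ μ (v.1, v.2.1)
      map_add' := fun u v => by
        simp only [forceFreeOperator_apply]
        refine Prod.ext ?_ ?_ <;> ext i <;> fin_cases i <;> simp <;> ring
      map_smul' := fun c v => by
        simp only [forceFreeOperator_apply]
        refine Prod.ext ?_ ?_ <;> ext i <;> fin_cases i <;> simp <;> ring }
  have hT : HasFDerivAt (fun v => LinearMap.toContinuousLinearMap T v + (l, 0))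
      (LinearMap.toContinuousLinearMap T) z :=
    (ContinuousLinearMap.hasFDerivAt _).add_const _
  have he : (forceFreeOperator l R α δ γ μ).toGenerator =
      fun v => LinearMap.toContinuousLinearMap T v + (l, 0) := by
    funext v
    simp only [PointField.toGenerator, LinearMap.coe_toContinuousLinearMap', T, LinearMap.coe_mk,
      AddHom.coe_mk, forceFreeOperator_apply]
    refine Prod.ext ?_ ?_ <;> ext i <;> fin_cases i <;>
      simp [Matrix.vecHead, Matrix.vecTail] <;> ring
  rw [he, hT.fderiv]
  rfl

theorem contDiff_forceFreeOperator (l : Vec3) (R α δ γ μ : ℝ) :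
    ContDiff ℝ ∞ (forceFreeOperator l R α δ γ μ).toGenerator := by
  have : (forceFreeOperator l R α δ γ μ).toGenerator = fun z : Jet1 =>
      (![l 0 + R * z.1 0 + δ * z.1 1 + γ * z.1 2, l 1 + R * z.1 1 - δ * z.1 0 + μ * z.1 2,
          l 2 + R * z.1 2 - γ * z.1 0 - μ * z.1 1],
        ![α * z.2.1 0 + δ * z.2.1 1 + γ * z.2.1 2, α * z.2.1 1 - δ * z.2.1 0 + μ * z.2.1 2,
          α * z.2.1 2 - γ * z.2.1 0 - μ * z.2.1 1]) := by
    funext z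
    exact forceFreeOperator_apply l R α δ γ μ z.1 z.2.1
  rw [this]
  refine ContDiff.prodMk (contDiff_pi.2 fun i => ?_) (contDiff_pi.2 fun i => ?_) <;>
    fin_cases i <;> simp <;> fun_prop

theorem admits_forceFreeOperator (l : Vec3) (R α δ γ μ : ℝ) :
    Admits Set.univ (forceFreeOperator l R α δ γ μ).toGenerator := by
  rintro ⟨x, B, p⟩ - w - a h
  obtain ⟨hc, hd⟩ := (forceFreeLHS_eq_zero_iff a x B p).1 h
  have h0 := congrFun hc 0
  have h1 := congrFun hc 1
  have h2 := congrFun hc 2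
  simp [curlOf] at h0 h1 h2
  simp [divOf, Fin.sum_univ_three] at hd
  -- The coefficient scales like an inverse length, and only the space scaling changes it.
  refine ⟨-(R * a), (prolongedAction_eq_zero_iff _ _ _ _ _).2 ⟨?_, ?_⟩⟩
  · ext i
    fin_cases i <;>
    simp [curlOf, prolongCoeff, fderiv_forceFreeOperator, forceFreeOperator_apply, totalDir,
      Fin.sum_univ_three, PointField.toGenerator] 
    · linear_combination (α - R) * h0 + δ * h1 + γ * h2
    · linear_combination (α - R) * h1 - δ * h0 + μ * h2
    · linear_combination (α - R) * h2 - γ * h0 - μ * h1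
  · simp [divOf, prolongCoeff, fderiv_forceFreeOperator, forceFreeOperator_apply, totalDir,
      Fin.sum_univ_three]
    linear_combination (α - R) * hd

/-! ### Tangential derivatives, characteristics and second jets. -/

-- A vector annihilated by the linearised system is the velocity of a curve lying in the shell, and
-- two functions that agree on the shell agree along that curve.
open Filter Topology in
theorem fderiv_eq_of_eq_onShell {W : Type*} [NormedAddCommGroup W] [NormedSpace ℝ W]
    {F : Jet1 → W} {G : ℝ × Jet1 → W} {a : ℝ} {z : Jet1}
    (hF : DifferentiableAt ℝ F z) (hG : DifferentiableAt ℝ G (a, z))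
    (h : ∀ᶠ y in 𝓝 (a, z), forceFreeLHS y = 0 → F y.2 = G y) (hz : forceFreeLHS (a, z) = 0)
    {δ : ℝ} {u β : Vec3} {r : Fin 3 → Fin 3 → ℝ}
    (hr : fderiv ℝ forceFreeLHS (a, z) (δ, u, β, r) = 0) :
    fderiv ℝ F z (u, β, r) = fderiv ℝ G (a, z) (δ, u, β, r) := by
  obtain ⟨x, B, p⟩ := z
  obtain ⟨hc, hd⟩ := (forceFreeLHS_eq_zero_iff a x B p).1 hz
  obtain ⟨hrc, hrd⟩ := (forceFreeLHS_consequence_iff _ _ _ _ _ _).1 hr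
  -- A straight line leaves the shell because α B is bilinear. The quadratic term has curl t²δβ,
  -- which cancels the error and does not change the velocity at 0.
  let c : ℝ → ℝ × Jet1 := fun t =>
    (a + t * δ, x + t • u, B + t • β, p + t • r + (t ^ 2 * (δ / 2)) • crossMat β)
  have hlin : ∀ {V : Type} [NormedAddCommGroup V] [NormedSpace ℝ V] (v₀ v : V),
      HasDerivAt (fun t : ℝ => v₀ + t • v) v 0 := fun v₀ v => by
    simpa using ((hasDerivAt_id (0 : ℝ)).smul_const v).const_add v₀
  have hq : HasDerivAt (fun t : ℝ => (t ^ 2 * (δ / 2)) • crossMat β) 0 0 := by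
    simpa using (((hasDerivAt_id (0 : ℝ)).pow 2).mul_const (δ / 2)).smul_const (crossMat β)
  have hcd : HasDerivAt c (δ, u, β, r) 0 := by
    have h3 := (hlin p r).add hq
    rw [add_zero] at h3
    exact (hlin a δ).prodMk ((hlin x u).prodMk ((hlin B β).prodMk h3))
  have hc0 : c 0 = (a, x, B, p) := by simp [c]
  have hon : ∀ t, forceFreeLHS (c t) = 0 := fun t => by
    refine (forceFreeLHS_eq_zero_iff _ _ _ _).2 ⟨?_, ?_⟩
    · rw [curlOf_add, curlOf_add, curlOf_smul, curlOf_smul, curlOf_crossMat, hc, hrc]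
      ext i
      simp
      ring
    · rw [divOf_add, divOf_add, divOf_smul, divOf_smul, divOf_crossMat, hd, hrd]
      simp
  have hFc : HasDerivAt (fun t => F (c t).2) (fderiv ℝ F (x, B, p) (u, β, r)) 0 := by
    have h1 : HasDerivAt (fun t => (c t).2) (u, β, r) 0 := hcd.snd
    exact HasFDerivAt.comp_hasDerivAt_of_eq 0 hF.hasFDerivAt h1 (by rw [hc0])
  have hGc : HasDerivAt (fun t => G (c t)) (fderiv ℝ G (a, x, B, p) (δ, u, β, r)) 0 :=
    HasFDerivAt.comp_hasDerivAt_of_eq 0 hG.hasFDerivAt hcd hc0.symm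
  have he : (fun t => F (c t).2) =ᶠ[𝓝 0] fun t => G (c t) := by
    have ht : Tendsto c (𝓝 0) (𝓝 (a, x, B, p)) := hc0 ▸ hcd.continuousAt.tendsto
    filter_upwards [ht.eventually h] with t h1
    exact h1 (hon t)
  exact hFc.unique (hGc.congr_of_eventuallyEq he)

theorem fderiv_characteristic {X : Generator} {z : Jet1} (hX : DifferentiableAt ℝ X z) (v : Jet1)
    (k : Fin 3) :
    DifferentiableAt ℝ (characteristic X) z ∧
    fderiv ℝ (characteristic X) z v k =
      (fderiv ℝ X z v).2 k - ∑ m, (v.2.2 k m * (X z).1 m + z.2.2 k m * (fderiv ℝ X z v).1 m) := by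
  have hdiff : DifferentiableAt ℝ (characteristic X) z := by
    refine differentiableAt_pi.2 fun k => ?_
    have h1 : ∀ m, DifferentiableAt ℝ (fun y => (X y).1 m) z := fun m =>
      differentiableAt_pi.1 hX.fst m
    have h2 : ∀ m, DifferentiableAt ℝ (fun y => (X y).2 m) z := fun m =>
      differentiableAt_pi.1 hX.snd m
    have h3 : ∀ m, DifferentiableAt ℝ (fun y : Jet1 => y.2.2 k m) z := fun m => by fun_prop
    exact (h2 k).sub (DifferentiableAt.fun_sum fun m _ => (h3 m).mul (h1 m))
  refine ⟨hdiff, ?_⟩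
  have hc : HasDerivAt (fun t : ℝ => z + t • v) v 0 := by
    simpa using ((hasDerivAt_id (0 : ℝ)).smul_const v).const_add z
  have hz : z = z + (0 : ℝ) • v := by simp
  have hQ := hasDerivAt_pi.1
    (HasFDerivAt.comp_hasDerivAt_of_eq 0 hdiff.hasFDerivAt hc hz) k
  have hX' := HasFDerivAt.comp_hasDerivAt_of_eq 0 hX.hasFDerivAt hc hz
  have h1 := hasDerivAt_pi.1 hX'.fst
  have h2 := hasDerivAt_pi.1 hX'.snd
  have h3 := fun m => hasDerivAt_pi.1 (hasDerivAt_pi.1 hc.snd.snd k) m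
  have h := (h2 k).sub (HasDerivAt.fun_sum (u := Finset.univ) fun m _ => (h3 m).mul (h1 m))
  have := hQ.unique h
  simpa using this

theorem prolongCoeff_eq {X : Generator} {z : Jet1} (hX : DifferentiableAt ℝ X z)
    {w : Fin 3 → Fin 3 → Fin 3 → ℝ} (k i : Fin 3) :
    prolongCoeff X z w k i = fderiv ℝ (characteristic X) z (totalDir z w i) k +
      ∑ m, w k i m * (X z).1 m := by
  rw [(fderiv_characteristic hX _ k).2, prolongCoeff]
  simp only [totalDir, Finset.sum_add_distrib]
  ring

/-- Solvability of the differentiated system for second derivatives. The trace of τ is the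
divergence of a curl, so its vanishing is the compatibility condition. -/
theorem exists_symmetric_of_curl (τ : Fin 3 → Fin 3 → ℝ) (hτ : ∑ i, τ i i = 0) :
    ∃ w : Fin 3 → Fin 3 → Fin 3 → ℝ, IsSecondJet w ∧
      ∀ i, curlOf (fun k j => w k i j) = τ i ∧ divOf (fun k j => w k i j) = 0 := by
  let σ : Fin 3 → Fin 3 → ℝ := fun i j => (τ i j + τ j i) / 4
  let u : Vec3 := (-(1 / 4 : ℝ)) • curlOf τ
  let d : Fin 3 → Fin 3 → ℝ := fun i j => if i = j then 1 else 0
  -- For each i the part antisymmetric in (k, j) must be `crossMat (τ i) / 2`. The remaining terms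
  -- are symmetric and trace-free in (k, j), and they restore symmetry in (i, j): σ handles the
  -- symmetric part of τ, u the antisymmetric part.
  refine ⟨fun k i j => -(1 / 3) * (crossMat (σ j) i k + crossMat (σ k) i j)
    - 3 / 5 * (u k * d i j + u j * d i k - 2 / 3 * u i * d k j)
    + crossMat (τ i) k j / 2, ?_, fun i => ⟨?_, ?_⟩⟩
  · rw [Fin.sum_univ_three] at hτ
    intro k i j
    have h0 : τ 0 0 = - τ 1 1 - τ 2 2 := by linarith
    fin_cases k <;> fin_cases i <;> fin_cases j <;>
      simp [crossMat, σ, u, d, curlOf, h0] <;> ring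
  · ext c
    fin_cases i <;> fin_cases c <;> simp [crossMat, σ, u, d, curlOf] <;> ring_nf
  · fin_cases i <;> simp [crossMat, σ, u, d, curlOf, divOf, Fin.sum_univ_three] <;> ring_nf

/-- The total derivatives of a first-order characteristic, as a matrix. -/
noncomputable def totalJacobian (Q : Jet1 → Vec3) (z : Jet1) (w : Fin 3 → Fin 3 → Fin 3 → ℝ) :
    Fin 3 → Fin 3 → ℝ :=
  fun k i => fderiv ℝ Q z (totalDir z w i) k

/-- The prolongation is DQ plus the transport of p along ξ. Since the second jet satisfies the
differentiated system, the transport term contributes only (ξ · grad α)B + α(η - Q) to the curl and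
nothing to the divergence. The first summand is absorbed by shifting b. -/
theorem exists_prolongedAction_eq_zero_iff {X : Generator} {z : Jet1}
    (hX : DifferentiableAt ℝ X z) {w : Fin 3 → Fin 3 → Fin 3 → ℝ} (hw : IsSecondJet w) {a : ℝ}
    {da : Vec3} (hda : ∀ j, fderiv ℝ forceFreeLHS (a, z) (da j, totalDir z w j) = 0) :
    (∃ b : ℝ, prolongedAction X a b z w = 0) ↔
      (∃ b : ℝ, curlOf (totalJacobian (characteristic X) z w) =
        a • characteristic X z + b • z.2.1) ∧
      divOf (totalJacobian (characteristic X) z w) = 0 := by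
  have hcurl := fun j => ((forceFreeLHS_consequence_iff _ _ _ _ _ _).1 (hda j)).1
  have hdiv := fun j => ((forceFreeLHS_consequence_iff _ _ _ _ _ _).1 (hda j)).2
  have hsplit : prolongCoeff X z w = totalJacobian (characteristic X) z w +
      (∑ m, (X z).1 m • fun k j => w k m j) := by
    ext k i
    rw [prolongCoeff_eq hX]
    simp only [totalJacobian, Pi.add_apply, Finset.sum_apply, Pi.smul_apply, smul_eq_mul]
    congr 1
    exact Finset.sum_congr rfl fun m _ => by rw [hw k i m, mul_comm]
  have hd : divOf (prolongCoeff X z w) = divOf (totalJacobian (characteristic X) z w) := by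
    rw [hsplit, divOf_add]
    simp only [Fin.sum_univ_three, divOf_add, divOf_smul, hdiv]
    simp
  have hc : curlOf (prolongCoeff X z w) = curlOf (totalJacobian (characteristic X) z w) +
      ((∑ m, (X z).1 m * da m) • z.2.1 + a • ((X z).2 - characteristic X z)) := by
    rw [hsplit, curlOf_add]
    congr 1
    simp only [Fin.sum_univ_three, curlOf_add, curlOf_smul, hcurl]
    ext k
    simp [characteristic, Fin.sum_univ_three]
    ring
  simp only [prolongedAction_eq_zero_iff, hd, hc, exists_and_right]
  refine and_congr_left fun _ => ⟨fun ⟨b, hb⟩ => ⟨b - ∑ m, (X z).1 m * da m, ?_⟩,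
    fun ⟨b, hb⟩ => ⟨b + ∑ m, (X z).1 m * da m, ?_⟩⟩
  · rw [← sub_eq_zero] at hb ⊢
    rw [← hb]
    module
  · rw [hb]
    module

theorem isOpen_jetsOver {D : Set Vec3} (hD : IsOpen D) : IsOpen (jetsOver D) :=
  (hD.preimage continuous_fst).inter
    (isOpen_ne.preimage (continuous_fst.comp continuous_snd))

theorem differentiableAt_of_contDiffOn_jetsOver {D : Set Vec3} (hD : IsOpen D) {X : Generator}
    (hX : ContDiffOn ℝ ∞ X (jetsOver D)) {z : Jet1} (hz : z ∈ jetsOver D) :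
    DifferentiableAt ℝ X z :=
  (hX.contDiffAt ((isOpen_jetsOver hD).mem_nhds hz)).differentiableAt (by simp)

theorem fderiv_characteristic_eq {D : Set Vec3} (hD : IsOpen D) {X Y : Generator}
    (hX : ContDiffOn ℝ ∞ X (jetsOver D)) (hY : ContDiffOn ℝ ∞ Y (jetsOver D))
    (h : ∀ z ∈ jetsOver D, OnShell z → characteristic X z = characteristic Y z)
    {z : Jet1} (hz : z ∈ jetsOver D) {a : ℝ} (ha : forceFreeLHS (a, z) = 0) {δ : ℝ} {v : Jet1}
    (hv : fderiv ℝ forceFreeLHS (a, z) (δ, v) = 0) :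
    fderiv ℝ (characteristic X) z v = fderiv ℝ (characteristic Y) z v := by
  have hXz := (fderiv_characteristic (differentiableAt_of_contDiffOn_jetsOver hD hX hz) v 0).1
  have hYz := (fderiv_characteristic (differentiableAt_of_contDiffOn_jetsOver hD hY hz) v 0).1
  have hG : HasFDerivAt (fun y : ℝ × Jet1 => characteristic Y y.2)
      ((fderiv ℝ (characteristic Y) z).comp (ContinuousLinearMap.snd ℝ ℝ Jet1)) (a, z) :=
    HasFDerivAt.comp (a, z) (g := characteristic Y) hYz.hasFDerivAt hasFDerivAt_snd
  have hnear : ∀ᶠ y in nhds (a, z), forceFreeLHS y = 0 →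
      characteristic X y.2 = characteristic Y y.2 := by
    have : ∀ᶠ y : ℝ × Jet1 in nhds (a, z), y.2 ∈ jetsOver D :=
      ((isOpen_jetsOver hD).preimage continuous_snd).mem_nhds hz
    filter_upwards [this] with y hy h0
    exact h _ hy ⟨y.1, h0⟩
  have := fderiv_eq_of_eq_onShell hXz hG.differentiableAt hnear ha hv
  rw [hG.fderiv] at this
  exact this

theorem admitsModConsequences_of_characteristic_eq {D : Set Vec3} (hD : IsOpen D)
    {X Y : Generator} (hX : ContDiffOn ℝ ∞ X (jetsOver D)) (hY : ContDiffOn ℝ ∞ Y (jetsOver D))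
    (h : ∀ z ∈ jetsOver D, OnShell z → characteristic X z = characteristic Y z)
    (hYa : AdmitsModConsequences (jetsOver D) Y) :
    AdmitsModConsequences (jetsOver D) X := by
  intro z hz w hw a da ha hda
  have hY' := hYa z hz w hw a da ha hda
  rw [exists_prolongedAction_eq_zero_iff (differentiableAt_of_contDiffOn_jetsOver hD hY hz) hw hda]
    at hY'
  rw [exists_prolongedAction_eq_zero_iff (differentiableAt_of_contDiffOn_jetsOver hD hX hz) hw hda]
  have hJ : totalJacobian (characteristic X) z w = totalJacobian (characteristic Y) z w := by
    ext k i
    exact congrFun (fderiv_characteristic_eq hD hX hY h hz ha (hda i)) k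
  rwa [hJ, h z hz ⟨a, ha⟩]

theorem Admits.admitsModConsequences {S : Set Jet1} {X : Generator} (h : Admits S X) :
    AdmitsModConsequences S X :=
  fun z hz w hw a _ ha _ => h z hz w hw a ha

/-! ### Dependence of the characteristic on the first derivatives. -/

/-- A symmetric trace-free matrix, in coordinates. -/
def symMat (s : Fin 5 → ℝ) : Fin 3 → Fin 3 → ℝ :=
  ![![s 0, s 2, s 3], ![s 2, s 1, s 4], ![s 3, s 4, -s 0 - s 1]]

theorem curlOf_symMat (s : Fin 5 → ℝ) : curlOf (symMat s) = 0 := by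
  ext i
  fin_cases i <;> simp [curlOf, symMat]

theorem divOf_symMat (s : Fin 5 → ℝ) : divOf (symMat s) = 0 := by
  simp [divOf, symMat, Fin.sum_univ_three]

theorem symMat_add (s t : Fin 5 → ℝ) : symMat (s + t) = symMat s + symMat t := by
  ext k i
  fin_cases k <;> fin_cases i <;> simp [symMat] <;> ring

theorem symMat_smul (c : ℝ) (s : Fin 5 → ℝ) : symMat (c • s) = c • symMat s := by
  ext k i
  fin_cases k <;> fin_cases i <;> simp [symMat] <;> ring

theorem mul_eq_mul_of_eq_smul {u v B : Vec3} {b c : ℝ} (hu : u = b • B) (hv : v = c • B)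
    (i j : Fin 3) : u i * v j = u j * v i := by
  rw [hu, hv]
  simp only [Pi.smul_apply, smul_eq_mul]
  ring

-- The admissible triples s are the totally symmetric trace-free tensors, that is, third derivatives
-- of harmonic cubics. All the curls lie on one line, so the cross product of any two vanishes; for
-- well-chosen pairs one of its components is a sum of squares.
set_option maxHeartbeats 1000000 in
theorem exists_eq_symMat_of_linear (L : (Fin 5 → ℝ) →ₗ[ℝ] Vec3) {B : Vec3}
    (h : ∀ s : Fin 3 → Fin 5 → ℝ, IsSecondJet (fun k i j => symMat (s i) k j) →
      divOf (fun k i => L (s i) k) = 0 ∧ ∃ b : ℝ, curlOf (fun k i => L (s i) k) = b • B) :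
    ∃ ξ : Vec3, ∀ s, L s = fun k => -∑ m, symMat s k m * ξ m := by
  obtain ⟨l, hl⟩ : ∃ l : Fin 5 → Vec3, ∀ s, L s = fun k =>
      s 0 * l 0 k + s 1 * l 1 k + s 2 * l 2 k + s 3 * l 3 k + s 4 * l 4 k := by
    refine ⟨fun j => L (Pi.single j 1), fun s => ?_⟩
    have := L.pi_apply_eq_sum_univ s
    rw [this]
    ext k
    simp only [Fin.sum_univ_five, Pi.add_apply, Pi.smul_apply, smul_eq_mul]
    congr! <;> simp [Pi.single_apply, eq_comm]
  -- The tests come in three pairs, one for each coordinate plane: up to scale, the real and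
  -- imaginary parts of (x + iy)³ and their analogues.
  obtain ⟨d1, b1, c1⟩ := h ![![1, -1, 0, 0, 0], ![0, 0, -1, 0, 0], 0] (by
    simp [IsSecondJet, Fin.forall_fin_succ, symMat])
  obtain ⟨d2, b2, c2⟩ := h ![![0, 0, 1, 0, 0], ![1, -1, 0, 0, 0], 0] (by
    simp [IsSecondJet, Fin.forall_fin_succ, symMat])
  obtain ⟨d3, b3, c3⟩ := h ![![1, 0, 0, 0, 0], 0, ![0, 0, 0, -1, 0]] (by
    simp [IsSecondJet, Fin.forall_fin_succ, symMat])
  obtain ⟨d4, b4, c4⟩ := h ![![0, 0, 0, 1, 0], 0, ![1, 0, 0, 0, 0]] (by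
    simp [IsSecondJet, Fin.forall_fin_succ, symMat])
  obtain ⟨d5, b5, c5⟩ := h ![0, ![0, 1, 0, 0, 0], ![0, 0, 0, 0, -1]] (by
    simp [IsSecondJet, Fin.forall_fin_succ, symMat])
  obtain ⟨d6, b6, c6⟩ := h ![0, ![0, 0, 0, 0, 1], ![0, 1, 0, 0, 0]] (by
    simp [IsSecondJet, Fin.forall_fin_succ, symMat])
  have e12 := mul_eq_mul_of_eq_smul c1 c2 0 1
  have e13 := mul_eq_mul_of_eq_smul c3 c4 0 2
  have e23 := mul_eq_mul_of_eq_smul c5 c6 1 2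
  simp [divOf, curlOf, hl, Fin.sum_univ_three] at d1 d2 d3 d4 d5 d6 e12 e13 e23
  have z1 : l 2 2 = 0 := by nlinarith [sq_nonneg (l 2 2), sq_nonneg (l 0 2 - l 1 2)]
  have z2 : l 0 2 - l 1 2 = 0 := by nlinarith [sq_nonneg (l 2 2), sq_nonneg (l 0 2 - l 1 2)]
  have z3 : l 3 1 = 0 := by nlinarith [sq_nonneg (l 3 1), sq_nonneg (l 0 1)]
  have z4 : l 0 1 = 0 := by nlinarith [sq_nonneg (l 3 1), sq_nonneg (l 0 1)]
  have z5 : l 4 0 = 0 := by nlinarith [sq_nonneg (l 4 0), sq_nonneg (l 1 0)]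
  have z6 : l 1 0 = 0 := by nlinarith [sq_nonneg (l 4 0), sq_nonneg (l 1 0)]
  refine ⟨![-l 2 1, -l 2 0, -l 3 0], fun s => ?_⟩
  rw [hl]
  ext k
  fin_cases k <;> simp [symMat, Fin.sum_univ_three]
  · linear_combination s 0 * (d1 + z6) + s 1 * z6 + s 4 * z5
  · linear_combination s 0 * z4 + s 1 * (z4 - d2) + s 3 * z3 + s 4 * (d6 - d4 + z2)
  · linear_combination s 0 * d4 + s 1 * (d4 - z2) + s 2 * z1 + s 3 * (d1 - d3 + z6) +
      s 4 * (z4 - d5 - d2)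

/-- Component k of G is unchanged when s moves without altering its row k. Its derivative is
unchanged too, and since row k of s' is arbitrary, this derivative determines all of ξ. Hence ξ is
invariant under such moves. -/
theorem eq_of_fderiv_eq_symMat {G : (Fin 5 → ℝ) → Vec3} (hG : Differentiable ℝ G)
    (h : ∀ s, ∃ ξ : Vec3, ∀ s', fderiv ℝ G s s' = fun k => -∑ m, symMat s' k m * ξ m) :
    ∃ ξ : Vec3, ∀ s, G s = fun k => G 0 k - ∑ m, symMat s k m * ξ m := by
  choose ξ hξ using h
  have hinv : ∀ (k : Fin 3) (N : Fin 5 → ℝ), (∀ m, symMat N k m = 0) → ∀ s, G (s + N) k = G s k := by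
    intro k N hN s
    have hd : ∀ t : ℝ, HasDerivAt (fun t : ℝ => G (s + t • N) k) 0 t := fun t => by
      have hc : HasDerivAt (fun t : ℝ => s + t • N) N t := by
        simpa using ((hasDerivAt_id t).smul_const N).const_add s
      have := hasDerivAt_pi.1 ((hG _).hasFDerivAt.comp_hasDerivAt t hc) k
      rw [hξ] at this
      simpa [hN] using this
    have := is_const_of_deriv_eq_zero (fun t => (hd t).differentiableAt) (fun t => (hd t).deriv) 1 0
    simpa using this
  have hfd : ∀ (k : Fin 3) (N : Fin 5 → ℝ), (∀ m, symMat N k m = 0) → ∀ s s',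
      fderiv ℝ G (s + N) s' k = fderiv ℝ G s s' k := by
    intro k N hN s s'
    have hk : ∀ y, fderiv ℝ (fun s => G s k) y s' = fderiv ℝ G y s' k := fun y => by
      rw [(hasFDerivAt_pi'.1 (hG y).hasFDerivAt k).fderiv]
      rfl
    rw [← hk, ← hk, ← fderiv_comp_add_right]
    simp only [hinv k N hN]
  have hconst : ∀ (k : Fin 3) (N : Fin 5 → ℝ), (∀ m, symMat N k m = 0) → ∀ s, ξ (s + N) = ξ s := by
    intro k N hN s
    have h0 := hfd k N hN s ![1, 0, 0, 0, 0]
    have h1 := hfd k N hN s ![0, 1, 0, 0, 0]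
    have h2 := hfd k N hN s ![0, 0, 1, 0, 0]
    have h3 := hfd k N hN s ![0, 0, 0, 1, 0]
    have h4 := hfd k N hN s ![0, 0, 0, 0, 1]
    rw [hξ, hξ] at h0 h1 h2 h3 h4
    ext m
    fin_cases k <;> simp [symMat, Fin.sum_univ_three] at h0 h1 h2 h3 h4 <;>
      fin_cases m <;> simp <;> linarith
  have hξ0 : ∀ s, ξ s = ξ 0 := by
    intro s
    -- The three summands have vanishing row 0, row 1 and row 2 respectively, so these moves reach
    -- every s from 0.
    have hs : s = ((0 + ![0, s 1, 0, 0, s 4]) + ![s 0, 0, 0, s 3, 0]) + ![0, 0, s 2, 0, 0] := by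
      ext i; fin_cases i <;> simp
    rw [hs, hconst 2, hconst 1, hconst 0] <;> intro m <;> fin_cases m <;> simp [symMat]
  refine ⟨ξ 0, fun s => ?_⟩
  ext k
  have hd : ∀ t : ℝ, HasDerivAt (fun t : ℝ => G (t • s) k + t * ∑ m, symMat s k m * ξ 0 m) 0 t := by
    intro t
    have hc : HasDerivAt (fun t : ℝ => t • s) s t := by
      simpa using (hasDerivAt_id t).smul_const s
    have := (hasDerivAt_pi.1 ((hG _).hasFDerivAt.comp_hasDerivAt t hc) k).add
      ((hasDerivAt_id t).mul_const (∑ m, symMat s k m * ξ 0 m))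
    simp only [hξ, hξ0, one_mul, neg_add_cancel] at this
    exact this
  have := is_const_of_deriv_eq_zero (fun t => (hd t).differentiableAt) (fun t => (hd t).deriv) 1 0
  simp at this
  linarith

/-- With grad α = 0, a second jet over z may be changed by any totally symmetric trace-free tensor.
The equations are affine in it, so subtracting a reference solution leaves the linear condition of
`exists_eq_symMat_of_linear`. -/
theorem exists_fderiv_characteristic_eq_symMat {D : Set Vec3} (hD : IsOpen D) {X : Generator}
    (hX : ContDiffOn ℝ ∞ X (jetsOver D)) (hXa : AdmitsModConsequences (jetsOver D) X)
    {z : Jet1} (hz : z ∈ jetsOver D) (hon : OnShell z) :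
    ∃ ξ : Vec3, ∀ s, fderiv ℝ (characteristic X) z (0, 0, symMat s) =
      fun k => -∑ m, symMat s k m * ξ m := by
  obtain ⟨a, ha⟩ := hon
  have hdiv := ((forceFreeLHS_eq_zero_iff a z.1 z.2.1 z.2.2).1 ha).2
  let L : (Fin 5 → ℝ) →ₗ[ℝ] Vec3 :=
    { toFun := fun s => fderiv ℝ (characteristic X) z (0, 0, symMat s)
      map_add' := fun s t => by rw [← map_add, symMat_add]; simp
      map_smul' := fun c s => by rw [symMat_smul, RingHom.id_apply, ← map_smul]; simp }
  obtain ⟨w, hw, hwc⟩ := exists_symmetric_of_curl (fun i => a • fun k => z.2.2 k i) (by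
    simp only [Pi.smul_apply, smul_eq_mul, ← Finset.mul_sum]
    rw [show ∑ i, z.2.2 i i = 0 from hdiv, mul_zero])
  have hcond : ∀ s : Fin 3 → Fin 5 → ℝ, IsSecondJet (fun k i j => symMat (s i) k j) →
      (∃ b : ℝ, curlOf (totalJacobian (characteristic X) z w + fun k i => L (s i) k) =
        a • characteristic X z + b • z.2.1) ∧
      divOf (totalJacobian (characteristic X) z w + fun k i => L (s i) k) = 0 := by
    intro s hs
    let w' : Fin 3 → Fin 3 → Fin 3 → ℝ := fun k i j => w k i j + symMat (s i) k j
    have hw' : IsSecondJet w' := fun k i j => by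
      change w k i j + symMat (s i) k j = w k j i + symMat (s j) k i
      rw [hw k i j]
      exact congrArg _ (hs k i j)
    have hda : ∀ j, fderiv ℝ forceFreeLHS (a, z) ((0 : Vec3) j, totalDir z w' j) = 0 := fun j => by
      refine (forceFreeLHS_consequence_iff _ _ _ _ _ _).2 ?_
      have : (fun k i => w' k j i) = (fun k i => w k j i) + symMat (s j) := rfl
      rw [this, curlOf_add, divOf_add, curlOf_symMat, divOf_symMat, (hwc j).1, (hwc j).2]
      simp
    have h := (exists_prolongedAction_eq_zero_iff
      (differentiableAt_of_contDiffOn_jetsOver hD hX hz) hw' hda).1 (hXa z hz w' hw' a 0 ha hda)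
    have hJ : totalJacobian (characteristic X) z w' =
        totalJacobian (characteristic X) z w + fun k i => L (s i) k := by
      ext k i
      have ht : totalDir z w' i = totalDir z w i + (0, 0, symMat (s i)) := by
        simp only [totalDir, Prod.mk_add_mk, add_zero]
        rfl
      change fderiv ℝ (characteristic X) z (totalDir z w' i) k = _
      rw [ht, map_add]
      rfl
    rwa [hJ] at h
  refine exists_eq_symMat_of_linear L (B := z.2.1) fun s hs => ?_
  obtain ⟨⟨b, hb⟩, hd⟩ := hcond s hs
  obtain ⟨⟨b₀, hb₀⟩, hd₀⟩ := hcond 0 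
    (by simp [IsSecondJet, Fin.forall_fin_succ, symMat])
  have h0 : (fun k i => L ((0 : Fin 3 → Fin 5 → ℝ) i) k) = 0 := by
    ext k i
    simp
  rw [h0, add_zero] at hb₀ hd₀
  rw [curlOf_add, hb₀] at hb
  rw [divOf_add, hd₀, zero_add] at hd
  refine ⟨hd, b - b₀, ?_⟩
  rw [← sub_eq_zero] at hb ⊢
  rw [← hb]
  module

/-- The 1-jet over `(x, B)` with `curl B = a B` whose Jacobian matrix has symmetric part
`symMat s`. -/
noncomputable def shellJet (s : Fin 5 → ℝ) (y : ℝ × Vec3 × Vec3) : Jet1 :=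
  (y.2.1, y.2.2, (y.1 / 2) • crossMat y.2.2 + symMat s)

theorem forceFreeLHS_shellJet (s : Fin 5 → ℝ) (y : ℝ × Vec3 × Vec3) :
    forceFreeLHS (y.1, shellJet s y) = 0 := by
  refine (forceFreeLHS_eq_zero_iff _ _ _ _).2 ⟨?_, ?_⟩
  · rw [curlOf_add, curlOf_smul, curlOf_crossMat, curlOf_symMat, add_zero, smul_smul]
    congr 1
    ring
  · rw [divOf_add, divOf_smul, divOf_crossMat, divOf_symMat]
    simp

theorem exists_eq_shellJet {a : ℝ} {x B : Vec3} {p : Fin 3 → Fin 3 → ℝ}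
    (h : forceFreeLHS (a, x, B, p) = 0) : ∃ s, (x, B, p) = shellJet s (a, x, B) := by
  obtain ⟨hc, hd⟩ := (forceFreeLHS_eq_zero_iff _ _ _ _).1 h
  refine ⟨![p 0 0, p 1 1, (p 0 1 + p 1 0) / 2, (p 0 2 + p 2 0) / 2, (p 1 2 + p 2 1) / 2], ?_⟩
  have h0 := congrFun hc 0
  have h1 := congrFun hc 1
  have h2 := congrFun hc 2
  simp [curlOf] at h0 h1 h2
  simp [divOf, Fin.sum_univ_three] at hd
  simp only [shellJet, Prod.mk.injEq, true_and]
  ext k i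
  fin_cases k <;> fin_cases i <;> simp [crossMat, symMat] <;> linarith

theorem contDiff_shellJet (s : Fin 5 → ℝ) : ContDiff ℝ ∞ (shellJet s) := by
  have hc : ContDiff ℝ ∞ fun y : ℝ × Vec3 × Vec3 => crossMat y.2.2 := by
    refine contDiff_pi.2 fun k => contDiff_pi.2 fun i => ?_
    fin_cases k <;> fin_cases i <;> simp [crossMat] <;> fun_prop
  have h1 : ContDiff ℝ ∞ fun y : ℝ × Vec3 × Vec3 => y.1 / 2 := by fun_prop
  exact (contDiff_fst.comp contDiff_snd).prodMk ((contDiff_snd.comp contDiff_snd).prodMk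
    ((h1.smul hc).add contDiff_const))

theorem contDiffOn_characteristic {S : Set Jet1} {X : Generator} (hX : ContDiffOn ℝ ∞ X S) :
    ContDiffOn ℝ ∞ (characteristic X) S := by
  refine contDiffOn_pi.2 fun k => ContDiffOn.sub (contDiffOn_pi.1 hX.snd k)
    (ContDiffOn.sum fun m _ => ContDiffOn.mul ?_ (contDiffOn_pi.1 hX.fst m))
  have : ContDiff ℝ ∞ fun z : Jet1 => z.2.2 k m := by fun_prop
  exact this.contDiffOn

/-- The data `(a, x, B)` over a set of points of space at which the field does not vanish. -/
def valuesOver (D : Set Vec3) : Set (ℝ × Vec3 × Vec3) := {y | y.2.1 ∈ D ∧ y.2.2 ≠ 0}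

theorem exists_characteristic_eq {D : Set Vec3} (hD : IsOpen D) {X : Generator}
    (hX : ContDiffOn ℝ ∞ X (jetsOver D)) (hXa : AdmitsModConsequences (jetsOver D) X) :
    ∃ Y : ℝ × Vec3 × Vec3 → Vec3 × Vec3, ContDiffOn ℝ ∞ Y (valuesOver D) ∧
      ∀ a, ∀ z ∈ jetsOver D, forceFreeLHS (a, z) = 0 →
        characteristic X z = characteristic (fun z => Y (a, z.1, z.2.1)) z := by
  have hmem : ∀ s, ∀ y ∈ valuesOver D, shellJet s y ∈ jetsOver D := fun s y hy => hy
  have hQ := contDiffOn_characteristic hX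
  have hfib : ∀ y ∈ valuesOver D, ∃ ξ : Vec3, ∀ s, characteristic X (shellJet s y) =
      fun k => characteristic X (shellJet 0 y) k - ∑ m, symMat s k m * ξ m := by
    intro y hy
    have hder : ∀ s, HasFDerivAt (fun s => shellJet s y)
        (LinearMap.toContinuousLinearMap
          ({ toFun := fun s => (0, 0, symMat s)
             map_add' := fun s t => by simp [symMat_add]
             map_smul' := fun c s => by simp [symMat_smul] } : (Fin 5 → ℝ) →ₗ[ℝ] Jet1)) s := by
      intro s
      have := (LinearMap.toContinuousLinearMap
          ({ toFun := fun s => (0, 0, symMat s)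
             map_add' := fun s t => by simp [symMat_add]
             map_smul' := fun c s => by simp [symMat_smul] } :
             (Fin 5 → ℝ) →ₗ[ℝ] Jet1)).hasFDerivAt (x := s) |>.const_add
               ((y.2.1, y.2.2, (y.1 / 2) • crossMat y.2.2) : Jet1)
      refine this.congr_of_eventuallyEq (Filter.Eventually.of_forall fun t => ?_)
      simp [shellJet]
    have hdQ : ∀ s, DifferentiableAt ℝ (characteristic X) (shellJet s y) := fun s =>
      (hQ.contDiffAt ((isOpen_jetsOver hD).mem_nhds (hmem s y hy))).differentiableAt (by simp)
    have hcomp := fun s => (hdQ s).hasFDerivAt.comp s (hder s)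
    refine eq_of_fderiv_eq_symMat (G := fun s => characteristic X (shellJet s y))
      (fun s => (hcomp s).differentiableAt) fun s => ?_
    obtain ⟨ξ, hξ⟩ := exists_fderiv_characteristic_eq_symMat hD hX hXa (hmem s y hy)
      ⟨y.1, forceFreeLHS_shellJet s y⟩
    refine ⟨ξ, fun s' => ?_⟩
    rw [← hξ s']
    exact congrArg (fun T : (Fin 5 → ℝ) →L[ℝ] Vec3 => T s') (hcomp s).fderiv
  let q : (Fin 5 → ℝ) → ℝ × Vec3 × Vec3 → Vec3 := fun s y => characteristic X (shellJet s y)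
  have hq : ∀ s, ContDiffOn ℝ ∞ (q s) (valuesOver D) := fun s =>
    hQ.comp (contDiff_shellJet s).contDiffOn fun y hy => hmem s y hy
  -- The vector from `hfib` is only chosen pointwise. Reading its coordinates off values of Q at
  -- fixed s, here diag(1, -1, 0) and the xz-shear, shows that it is smooth.
  let ξ : ℝ × Vec3 × Vec3 → Vec3 := fun y =>
    ![q 0 y 0 - q ![1, -1, 0, 0, 0] y 0, q ![1, -1, 0, 0, 0] y 1 - q 0 y 1,
      q 0 y 0 - q ![0, 0, 0, 1, 0] y 0]
  have hξ : ContDiffOn ℝ ∞ ξ (valuesOver D) := by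
    have hc := fun s k => contDiffOn_pi.1 (hq s) k
    refine contDiffOn_pi.2 fun i => ?_
    fin_cases i
    · exact (hc _ _).sub (hc _ _)
    · exact (hc _ _).sub (hc _ _)
    · exact (hc _ _).sub (hc _ _)
  have hfib' : ∀ y ∈ valuesOver D, ∀ s, q s y = fun k => q 0 y k - ∑ m, symMat s k m * ξ y m := by
    intro y hy s
    obtain ⟨ξ', h'⟩ := hfib y hy
    have : ξ y = ξ' := by
      ext i
      fin_cases i <;> simp [ξ, q, h' ![1, -1, 0, 0, 0], h' ![0, 0, 0, 1, 0], symMat,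
        Fin.sum_univ_three]
    rw [this]
    exact h' s
  let η : ℝ × Vec3 × Vec3 → Vec3 := fun y k =>
    q 0 y k + ∑ m, (shellJet 0 y).2.2 k m * ξ y m
  have hη : ContDiffOn ℝ ∞ η (valuesOver D) := by
    refine contDiffOn_pi.2 fun k => (contDiffOn_pi.1 (hq 0) k).add
      (ContDiffOn.sum fun m _ => ContDiffOn.mul ?_ (contDiffOn_pi.1 hξ m))
    exact (contDiff_pi.1 (contDiff_pi.1 (contDiff_shellJet 0).snd.snd k) m).contDiffOn
  refine ⟨fun y => (ξ y, η y), hξ.prodMk hη, ?_⟩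
  rintro a ⟨x, B, p⟩ hz ha
  obtain ⟨s, hs⟩ := exists_eq_shellJet ha
  have hy : (a, x, B) ∈ valuesOver D := hz
  have hp : p = (shellJet s (a, x, B)).2.2 := by rw [← hs]
  have h1 : characteristic X (x, B, p) = q s (a, x, B) := by rw [hs]
  rw [h1, hfib' _ hy s]
  ext k
  simp only [characteristic, η, hp, shellJet, Fin.sum_univ_three, Pi.add_apply]
  simp [show symMat 0 = 0 by simpa using symMat_smul 0 0]
  ring

/-! ### Independence of the coefficient: reduction to point fields. -/

/-- The value of the coefficient `α` on the jet: `(B · curl B) / |B|²`. -/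
noncomputable def coeffOf (z : Jet1) : ℝ :=
  (∑ i, z.2.1 i * curlOf z.2.2 i) / ∑ i, z.2.1 i * z.2.1 i

theorem sum_mul_self_ne_zero {B : Vec3} (hB : B ≠ 0) : ∑ i, B i * B i ≠ 0 := by
  intro h
  rw [Finset.sum_eq_zero_iff_of_nonneg fun i _ => mul_self_nonneg _] at h
  exact hB (funext fun i => mul_self_eq_zero.1 (h i (Finset.mem_univ i)))

theorem coeffOf_eq {a : ℝ} {z : Jet1} (hB : z.2.1 ≠ 0) (h : forceFreeLHS (a, z) = 0) :
    coeffOf z = a := by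
  rw [coeffOf, ((forceFreeLHS_eq_zero_iff a z.1 z.2.1 z.2.2).1 h).1,
    div_eq_iff (sum_mul_self_ne_zero hB), Finset.mul_sum]
  exact Finset.sum_congr rfl fun i _ => by simp; ring

theorem contDiffOn_coeffOf (D : Set Vec3) : ContDiffOn ℝ ∞ coeffOf (jetsOver D) := by
  refine ContDiffOn.div (ContDiff.contDiffOn ?_) (ContDiff.contDiffOn ?_)
    fun z hz => sum_mul_self_ne_zero hz.2
  · simp only [Fin.sum_univ_three, curlOf]
    simp
    fun_prop
  · fun_prop

/-- The two conditions read d × q ∥ B and d · q = 0. Taking d = B × eᵢ up to sign, the second gives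
q × B = 0 and the first gives B · q = 0. -/
theorem eq_zero_of_forall_perp {B q : Vec3} (hB : B ≠ 0)
    (h : ∀ d : Vec3, ∑ i, d i * B i = 0 →
      (∃ b : ℝ, curlOf (fun k i => d i * q k) = b • B) ∧ divOf (fun k i => d i * q k) = 0) :
    q = 0 := by
  obtain ⟨⟨b0, c0⟩, d0⟩ := h ![0, B 2, -B 1] (by simp [Fin.sum_univ_three]; ring)
  obtain ⟨⟨b1, c1⟩, d1⟩ := h ![-B 2, 0, B 0] (by simp [Fin.sum_univ_three]; ring)
  obtain ⟨⟨b2, c2⟩, d2⟩ := h ![B 1, -B 0, 0] (by simp [Fin.sum_univ_three]; ring)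
  have hBB : B = (1 : ℝ) • B := (one_smul _ _).symm
  have e0 := mul_eq_mul_of_eq_smul c0 hBB 0 1
  have e1 := mul_eq_mul_of_eq_smul c1 hBB 1 2
  have e2 := mul_eq_mul_of_eq_smul c2 hBB 2 0
  simp [curlOf, divOf, Fin.sum_univ_three] at d0 d1 d2 e0 e1 e2
  have hs : B 0 * q 0 + B 1 * q 1 + B 2 * q 2 = 0 := by
    by_contra hne
    apply hB
    ext i
    refine (mul_eq_zero.1 ?_).resolve_left hne
    fin_cases i <;> simp only [Fin.zero_eta, Fin.mk_one, Fin.reduceFinMk]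
    · linear_combination e2
    · linear_combination e0
    · linear_combination e1
  ext k
  refine (mul_eq_zero.1 ?_).resolve_left (sum_mul_self_ne_zero hB)
  rw [Fin.sum_univ_three]
  fin_cases k <;> simp only [Fin.zero_eta, Fin.mk_one, Fin.reduceFinMk]
  · linear_combination B 0 * hs + B 1 * d2 - B 2 * d1
  · linear_combination B 1 * hs + B 2 * d0 - B 0 * d2
  · linear_combination B 2 * hs + B 0 * d1 - B 1 * d0

theorem exists_pointField {D : Set Vec3} (hD : IsOpen D) {X : Generator}
    (hX : ContDiffOn ℝ ∞ X (jetsOver D)) (hXa : AdmitsModConsequences (jetsOver D) X) :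
    ∃ V : PointField, ContDiffOn ℝ ∞ V {q | q.1 ∈ D ∧ q.2 ≠ 0} ∧
      ∀ z ∈ jetsOver D, OnShell z → characteristic X z = characteristic V.toGenerator z := by
  obtain ⟨Y, hY, hchar⟩ := exists_characteristic_eq hD hX hXa
  have hopen : IsOpen (valuesOver D) :=
    (hD.preimage (continuous_fst.comp continuous_snd)).inter
      (isOpen_ne.preimage (continuous_snd.comp continuous_snd))
  have hYd : ∀ y ∈ valuesOver D, DifferentiableAt ℝ Y y := fun y hy =>
    (hY.contDiffAt (hopen.mem_nhds hy)).differentiableAt (by simp)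
  -- Expressing α through the jet turns Y into a generator with the same characteristic as X on the
  -- shell, hence admitted modulo consequences.
  let Z : Generator := fun z => Y (coeffOf z, z.1, z.2.1)
  have hZ : ContDiffOn ℝ ∞ Z (jetsOver D) :=
    hY.comp ((contDiffOn_coeffOf D).prodMk (contDiffOn_fst.prodMk contDiff_snd.fst.contDiffOn))
      fun z hz => hz
  have hXZ : ∀ z ∈ jetsOver D, OnShell z → characteristic X z = characteristic Z z := by
    rintro z hz ⟨a, ha⟩
    rw [hchar a z hz ha, ← coeffOf_eq hz.2 ha]
    rfl
  have hZa : AdmitsModConsequences (jetsOver D) Z :=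
    admitsModConsequences_of_characteristic_eq hD hZ hX (fun z hz h => (hXZ z hz h).symm) hXa
  have hZd : ∀ z ∈ jetsOver D, ∀ a, forceFreeLHS (a, z) = 0 → ∀ (δ : ℝ) (v : Jet1),
      fderiv ℝ forceFreeLHS (a, z) (δ, v) = 0 →
      fderiv ℝ Z z v = fderiv ℝ Y (a, z.1, z.2.1) (δ, v.1, v.2.1) := by
    intro z hz a ha δ v hv
    let T : ℝ × Jet1 →L[ℝ] ℝ × Vec3 × Vec3 :=
      (ContinuousLinearMap.fst ℝ ℝ Jet1).prod
        (((ContinuousLinearMap.fst ℝ Vec3 _).comp (ContinuousLinearMap.snd ℝ ℝ Jet1)).prod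
          (((ContinuousLinearMap.fst ℝ Vec3 _).comp (ContinuousLinearMap.snd ℝ Vec3 _)).comp
            (ContinuousLinearMap.snd ℝ ℝ Jet1)))
    have hG : HasFDerivAt (fun y : ℝ × Jet1 => Y (y.1, y.2.1, y.2.2.1))
        ((fderiv ℝ Y (a, z.1, z.2.1)).comp T) (a, z) :=
      HasFDerivAt.comp (a, z) (g := Y) (f := fun y : ℝ × Jet1 => (y.1, y.2.1, y.2.2.1))
        (hYd (a, z.1, z.2.1) hz).hasFDerivAt T.hasFDerivAt
    have hnear : ∀ᶠ y in nhds (a, z), forceFreeLHS y = 0 → Z y.2 = Y (y.1, y.2.1, y.2.2.1) := by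
      have : ∀ᶠ y : ℝ × Jet1 in nhds (a, z), y.2 ∈ jetsOver D :=
        ((isOpen_jetsOver hD).preimage continuous_snd).mem_nhds hz
      filter_upwards [this] with y hy h0
      simp only [Z]
      rw [coeffOf_eq hy.2 h0]
    have := fderiv_eq_of_eq_onShell (differentiableAt_of_contDiffOn_jetsOver hD hZ hz)
      hG.differentiableAt hnear ha hv
    rw [hG.fderiv] at this
    exact this
  -- The compatibility condition allows every gradient d of α with d · B = 0. Replacing gradient 0
  -- by d adds d ⊗ (∂η/∂α - p ∂ξ/∂α) to the prolongation, so this vector vanishes for every p on the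
  -- shell. Letting s vary then separates ∂ξ/∂α from ∂η/∂α.
  have hder : ∀ y ∈ valuesOver D, fderiv ℝ Y y (1, 0, 0) = 0 := by
    intro y hy
    have hq : ∀ s : Fin 5 → ℝ, (fun k => (fderiv ℝ Y y (1, 0, 0)).2 k -
        ∑ m, (shellJet s y).2.2 k m * (fderiv ℝ Y y (1, 0, 0)).1 m) = 0 := by
      intro s
      have hz : shellJet s y ∈ jetsOver D := hy
      have ha := forceFreeLHS_shellJet s y
      obtain ⟨-, hdiv⟩ := (forceFreeLHS_eq_zero_iff _ _ _ _).1 ha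
      have hcond : ∀ d : Vec3, ∑ i, d i * y.2.2 i = 0 →
          (∃ b : ℝ, curlOf (fun k i =>
            (fderiv ℝ Y y (d i, Pi.single i 1, fun l => (shellJet s y).2.2 l i)).2 k -
            ∑ m, (shellJet s y).2.2 k m *
              (fderiv ℝ Y y (d i, Pi.single i 1, fun l => (shellJet s y).2.2 l i)).1 m) =
            y.1 • (Z (shellJet s y)).2 + b • y.2.2) ∧
          divOf (fun k i =>
            (fderiv ℝ Y y (d i, Pi.single i 1, fun l => (shellJet s y).2.2 l i)).2 k -
            ∑ m, (shellJet s y).2.2 k m *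
              (fderiv ℝ Y y (d i, Pi.single i 1, fun l => (shellJet s y).2.2 l i)).1 m) = 0 := by
        intro d hd
        obtain ⟨w, hw, hwc⟩ := exists_symmetric_of_curl
          (fun i => d i • y.2.2 + y.1 • fun k => (shellJet s y).2.2 k i) (by
            have : ∑ i, (shellJet s y).2.2 i i = 0 := hdiv
            simp only [Pi.add_apply, Pi.smul_apply, smul_eq_mul, Finset.sum_add_distrib,
              ← Finset.mul_sum, this, hd]
            simp)
        have hda : ∀ j, fderiv ℝ forceFreeLHS (y.1, shellJet s y)
            (d j, totalDir (shellJet s y) w j) = 0 := fun j =>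
          (forceFreeLHS_consequence_iff _ _ _ _ _ _).2 (hwc j)
        obtain ⟨b, hb⟩ := hZa _ hz w hw y.1 d ha hda
        obtain ⟨h1, h2⟩ := (prolongedAction_eq_zero_iff _ _ _ _ _).1 hb
        have hp : prolongCoeff Z (shellJet s y) w = fun k i =>
            (fderiv ℝ Y y (d i, Pi.single i 1, fun l => (shellJet s y).2.2 l i)).2 k -
            ∑ m, (shellJet s y).2.2 k m *
              (fderiv ℝ Y y (d i, Pi.single i 1, fun l => (shellJet s y).2.2 l i)).1 m := by
          ext k i
          rw [prolongCoeff, hZd _ hz y.1 ha _ _ (hda i)]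
          rfl
        rw [hp] at h1 h2
        exact ⟨⟨b, h1⟩, h2⟩
      obtain ⟨⟨b₀, c₀⟩, d₀⟩ := hcond 0 (by simp)
      refine eq_zero_of_forall_perp (B := y.2.2) hy.2 fun d hd => ?_
      obtain ⟨⟨b, c⟩, d'⟩ := hcond d hd
      have hsplit : (fun k i =>
            (fderiv ℝ Y y (d i, Pi.single i 1, fun l => (shellJet s y).2.2 l i)).2 k -
            ∑ m, (shellJet s y).2.2 k m *
              (fderiv ℝ Y y (d i, Pi.single i 1, fun l => (shellJet s y).2.2 l i)).1 m) =
          (fun k i =>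
            (fderiv ℝ Y y ((0 : Vec3) i, Pi.single i 1, fun l => (shellJet s y).2.2 l i)).2 k -
            ∑ m, (shellJet s y).2.2 k m *
              (fderiv ℝ Y y ((0 : Vec3) i, Pi.single i 1, fun l => (shellJet s y).2.2 l i)).1 m) +
          (fun k i => d i * ((fderiv ℝ Y y (1, 0, 0)).2 k -
            ∑ m, (shellJet s y).2.2 k m * (fderiv ℝ Y y (1, 0, 0)).1 m)) := by
        ext k i
        have hv : ((d i, Pi.single i 1, fun l => (shellJet s y).2.2 l i) : ℝ × Vec3 × Vec3) =
            ((0 : Vec3) i, Pi.single i 1, fun l => (shellJet s y).2.2 l i) +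
              d i • ((1, 0, 0) : ℝ × Vec3 × Vec3) := by
          simp
        rw [hv, map_add, map_smul]
        simp [Fin.sum_univ_three]
        ring
      rw [hsplit, curlOf_add, c₀] at c
      rw [hsplit, divOf_add, d₀, zero_add] at d'
      refine ⟨⟨b - b₀, ?_⟩, d'⟩
      rw [← sub_eq_zero] at c ⊢
      refine Eq.trans ?_ c
      module
    have h0 := hq 0
    have h1 := hq ![1, -1, 0, 0, 0]
    have h2 := hq ![0, 0, 0, 1, 0]
    have g := fun k => congrFun h0 k
    have g10 := congrFun h1 0
    have g11 := congrFun h1 1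
    have g20 := congrFun h2 0
    have g0 := g 0
    have g1 := g 1
    simp [shellJet, symMat, Fin.sum_univ_three] at g0 g1 g10 g11 g20
    have hξ : (fderiv ℝ Y y (1, 0, 0)).1 = 0 := by
      ext i
      fin_cases i <;> simp <;> linarith
    refine Prod.ext hξ ?_
    ext k
    have := g k
    rw [hξ] at this
    simpa using this
  have hconst : ∀ y ∈ valuesOver D, Y y = Y (0, y.2) := by
    intro y hy
    have hd : ∀ t : ℝ, HasDerivAt (fun t : ℝ => Y (t, y.2)) 0 t := fun t => by
      have hc : HasDerivAt (fun t : ℝ => (t, y.2)) (1, 0) t :=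
        (hasDerivAt_id t).prodMk (hasDerivAt_const t y.2)
      have := (hYd (t, y.2) hy).hasFDerivAt.comp_hasDerivAt t hc
      rwa [show ((1, 0) : ℝ × Vec3 × Vec3) = (1, 0, 0) from rfl, hder (t, y.2) hy] at this
    exact is_const_of_deriv_eq_zero (fun t => (hd t).differentiableAt) (fun t => (hd t).deriv) y.1 0
  refine ⟨fun q => Y (0, q), hY.comp (contDiff_const.prodMk contDiff_id).contDiffOn fun q hq => hq,
    ?_⟩
  rintro z hz ⟨a, ha⟩
  rw [hchar a z hz ha]
  exact congrArg (fun v : Vec3 × Vec3 => fun k => v.2 k - ∑ m, z.2.2 k m * v.1 m)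
    (hconst (a, z.1, z.2.1) hz)

/-! ### Point fields: the determining equations at one point. -/

/-- The first prolongation of a point field at a jet with Jacobian matrix `p`; here `K`, `M` are the
derivatives of `ξ` and `N`, `H` those of `η` with respect to `x` and `B`. -/
def pointProlong (N H K M p : Fin 3 → Fin 3 → ℝ) : Fin 3 → Fin 3 → ℝ := fun k i =>
  N k i + ∑ l, H k l * p l i - ∑ m, p k m * (K m i + ∑ l, M m l * p l i)

theorem eq_zero_of_sum_mul_self {v : Vec3} (h : v 0 * v 0 + v 1 * v 1 + v 2 * v 2 = 0) : v = 0 := by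
  by_contra hv
  exact sum_mul_self_ne_zero hv (by rw [Fin.sum_univ_three, h])

/-- The form is tr(pMp). Symmetric trace-free p leave only M = m × ·, and a p mixing a rotation
about B with a symmetric part excludes m. -/
theorem quadratic_part_eq_zero {M : Fin 3 → Fin 3 → ℝ} {B : Vec3} (hB : B ≠ 0)
    (h : ∀ (a : ℝ) (p : Fin 3 → Fin 3 → ℝ), curlOf p = a • B → divOf p = 0 →
      ∑ k, ∑ m, p k m * ∑ l, M m l * p l k = 0) : M = 0 := by
  have hs : ∀ s, ∑ k, ∑ m, symMat s k m * ∑ l, M m l * symMat s l k = 0 := fun s =>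
    h 0 _ (by rw [curlOf_symMat, zero_smul]) (divOf_symMat s)
  have s1 := hs ![1, -1, 0, 0, 0]
  have s2 := hs ![0, 1, 0, 0, 0]
  have s3 := hs ![1, 0, 0, 0, 0]
  have s4 := hs ![0, 0, 1, 1, 0]
  have s5 := hs ![0, 0, 1, 0, 1]
  have s6 := hs ![0, 0, 0, 1, 1]
  simp [symMat, Fin.sum_univ_three] at s1 s2 s3 s4 s5 s6
  have d0 : M 0 0 = 0 := by linarith
  have d1 : M 1 1 = 0 := by linarith
  have d2 : M 2 2 = 0 := by linarith
  obtain ⟨m, rfl⟩ : ∃ m, M = crossMat m := by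
    refine ⟨![M 2 1, M 0 2, M 1 0], ?_⟩
    ext i j
    fin_cases i <;> fin_cases j <;> simp [crossMat] <;> linarith
  -- The symmetric part is m ⊗ B + B ⊗ m made trace-free. With it the form becomes a multiple of
  -- |m|²|B|² + (m · B)²/3.
  have hm := h 2 (crossMat B + symMat ![2 * (m 0 * B 0) - 2 / 3 * ∑ i, m i * B i,
    2 * (m 1 * B 1) - 2 / 3 * ∑ i, m i * B i, m 0 * B 1 + m 1 * B 0, m 0 * B 2 + m 2 * B 0,
    m 1 * B 2 + m 2 * B 1])
    (by rw [curlOf_add, curlOf_crossMat, curlOf_symMat, add_zero])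
    (by rw [divOf_add, divOf_crossMat, divOf_symMat, add_zero])
  have key : (m 0 * m 0 + m 1 * m 1 + m 2 * m 2) * ∑ i, B i * B i +
      (1 / 3) * (∑ i, m i * B i) * (∑ i, m i * B i) = 0 := by
    simp [symMat, crossMat, Fin.sum_univ_three] at hm ⊢
    linarith
  have hm0 : m = 0 := by
    refine eq_zero_of_sum_mul_self ((mul_eq_zero.1 ?_).resolve_right (sum_mul_self_ne_zero hB))
    have h1 : 0 ≤ (m 0 * m 0 + m 1 * m 1 + m 2 * m 2) * ∑ i, B i * B i := by
      refine mul_nonneg ?_ (Finset.sum_nonneg fun i _ => mul_self_nonneg _)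
      nlinarith [mul_self_nonneg (m 0), mul_self_nonneg (m 1), mul_self_nonneg (m 2)]
    nlinarith [mul_self_nonneg (∑ i, m i * B i)]
  rw [hm0]
  ext i j
  fin_cases i <;> fin_cases j <;> simp [crossMat]

/-- The matrix `t + v × ·` of an infinitesimal similarity. -/
def similarityMat (t : ℝ) (v : Vec3) : Fin 3 → Fin 3 → ℝ :=
  ![![t, -v 2, v 1], ![v 2, t, -v 0], ![-v 1, v 0, t]]

/-- The divergence says tr((H - K)p) = 0 on the shell, whence H - K = t + g × · with g · B = 0. Once
g = 0, the curl for symmetric p sees only the commutator of p with the symmetric part of K. Such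
commutators have axial vectors on a single line only if that part is scalar. -/
theorem conformal_of_curl_parallel {H K : Fin 3 → Fin 3 → ℝ} {B : Vec3}
    (hdiv : ∀ (a : ℝ) (p : Fin 3 → Fin 3 → ℝ), curlOf p = a • B → divOf p = 0 →
      ∑ k, (∑ l, H k l * p l k - ∑ m, p k m * K m k) = 0)
    (hcurl : ∀ s, ∃ b : ℝ, curlOf (fun k i =>
      ∑ l, H k l * symMat s l i - ∑ m, symMat s k m * K m i) = b • B) :
    ∃ (κ h : ℝ) (v : Vec3), K = similarityMat κ v ∧ H = similarityMat h v := by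
  have hs : ∀ s, ∑ k, (∑ l, H k l * symMat s l k - ∑ m, symMat s k m * K m k) = 0 := fun s =>
    hdiv 0 _ (by rw [curlOf_symMat, zero_smul]) (divOf_symMat s)
  have s1 := hs ![1, 0, 0, 0, 0]
  have s2 := hs ![0, 1, 0, 0, 0]
  have s3 := hs ![0, 0, 1, 0, 0]
  have s4 := hs ![0, 0, 0, 1, 0]
  have s5 := hs ![0, 0, 0, 0, 1]
  have s6 := hdiv 2 (crossMat B) (curlOf_crossMat B) (divOf_crossMat B)
  simp [symMat, Fin.sum_univ_three] at s1 s2 s3 s4 s5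
  obtain ⟨g, t, hH⟩ : ∃ (g : Vec3) (t : ℝ),
      H = K + similarityMat t g := by
    refine ⟨![H 2 1 - K 2 1, H 0 2 - K 0 2, H 1 0 - K 1 0], H 0 0 - K 0 0, ?_⟩
    ext i j
    fin_cases i <;> fin_cases j <;> simp [similarityMat] <;> linarith
  subst hH
  have hgB : g 0 * B 0 + g 1 * B 1 + g 2 * B 2 = 0 := by
    simp [crossMat, similarityMat, Fin.sum_univ_three] at s6
    linarith
  have hg : g = 0 := by
    -- For s = g ⊗ g made trace-free, the commutator with K has curl orthogonal to g, and g × s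
    -- contributes -(2/3)|g|²g. Pairing with g and using g · B = 0 gives |g|⁴ = 0.
    obtain ⟨b, hb⟩ := hcurl ![g 0 * g 0 - (∑ i, g i * g i) / 3, g 1 * g 1 - (∑ i, g i * g i) / 3,
      g 0 * g 1, g 0 * g 2, g 1 * g 2]
    have h0 := congrFun hb 0
    have h1 := congrFun hb 1
    have h2 := congrFun hb 2
    refine eq_zero_of_sum_mul_self (mul_self_eq_zero.1 ?_)
    simp [curlOf, symMat, similarityMat, Fin.sum_univ_three] at h0 h1 h2
    linear_combination (-3 / 2) * (g 0 * h0 + g 1 * h1 + g 2 * h2) - (3 / 2) * b * hgB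
  subst hg
  obtain ⟨b1, c1⟩ := hcurl ![1, -1, 0, 0, 0]
  obtain ⟨b3, c3⟩ := hcurl ![0, 0, 1, 0, 0]
  obtain ⟨b4, c4⟩ := hcurl ![0, 0, 0, 1, 0]
  obtain ⟨b5, c5⟩ := hcurl ![0, 0, 0, 0, 1]
  have e13 := mul_eq_mul_of_eq_smul c1 c3 0 1
  clear hdiv hcurl hs s1 s2 s3 s4 s5 s6 hgB
  have e14 := mul_eq_mul_of_eq_smul c1 c4 0 2
  have e15 := mul_eq_mul_of_eq_smul c1 c5 1 2
  have e34 := mul_eq_mul_of_eq_smul c3 c4 1 2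
  have e35 := mul_eq_mul_of_eq_smul c3 c5 0 2
  have e45 := mul_eq_mul_of_eq_smul c4 c5 0 1
  clear c1 c3 c4 c5
  simp [curlOf, symMat, similarityMat, Fin.sum_univ_three] at e13 e14 e15 e34 e35 e45
  have hsq : (K 0 2 + K 2 0) ^ 2 + (K 1 2 + K 2 1) ^ 2 = 0 := by linear_combination e13
  have hq : K 2 0 = -K 0 2 := by
    refine eq_neg_of_add_eq_zero_right
      (pow_eq_zero_iff two_ne_zero |>.1 (le_antisymm ?_ (sq_nonneg _)))
    linarith [sq_nonneg (K 1 2 + K 2 1)]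
  have hr : K 2 1 = -K 1 2 := by
    refine eq_neg_of_add_eq_zero_right
      (pow_eq_zero_iff two_ne_zero |>.1 (le_antisymm ?_ (sq_nonneg _)))
    linarith [sq_nonneg (K 0 2 + K 2 0)]
  have hp : K 1 0 = -K 0 1 := by
    refine eq_neg_of_add_eq_zero_right (pow_eq_zero_iff two_ne_zero |>.1 ?_)
    rw [hq] at e15
    linear_combination (-1 / 2) * e15
  rw [hr] at e34
  rw [hq] at e35
  rw [hp] at e45
  have hu : K 1 1 = K 0 0 := by
    refine sub_eq_zero.1 (pow_eq_zero_iff two_ne_zero |>.1 ?_)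
    linear_combination (1 / 4) * (e34 + e35)
  have hv : K 2 2 = K 0 0 := by
    refine sub_eq_zero.1 (pow_eq_zero_iff two_ne_zero |>.1 ?_)
    linear_combination (1 / 4) * (e34 + e45)
  refine ⟨K 0 0, K 0 0 + t, ![K 2 1, K 0 2, K 1 0], ?_, ?_⟩ <;> ext i j <;> fin_cases i <;>
    fin_cases j <;> simp [similarityMat, hp, hq, hr, hu, hv]

/-- What the determining equations of a point field say about its derivatives at one point. -/
theorem pointProlong_consequences {N H K M : Fin 3 → Fin 3 → ℝ} {η B : Vec3} (hB : B ≠ 0)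
    (h : ∀ (a : ℝ) (p : Fin 3 → Fin 3 → ℝ), curlOf p = a • B → divOf p = 0 →
      (∃ b : ℝ, curlOf (pointProlong N H K M p) = a • η + b • B) ∧
        divOf (pointProlong N H K M p) = 0) :
    M = 0 ∧ ((∃ b : ℝ, curlOf N = b • B) ∧ divOf N = 0) ∧
      ∃ (κ t c : ℝ) (v : Vec3), K = similarityMat κ v ∧ H = similarityMat t v ∧
        η = fun k => ∑ l, similarityMat c v k l * B l := by
  have hcross : curlOf (crossMat B) = (2 : ℝ) • B := curlOf_crossMat B
  have h0 : pointProlong N H K M 0 = N := by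
    ext k i
    simp [pointProlong]
  have hN := h 0 0 (by ext i; fin_cases i <;> simp [curlOf]) (by simp [divOf])
  simp only [h0, zero_smul, zero_add] at hN
  have hM : M = 0 := by
    refine quadratic_part_eq_zero hB fun a p hc hd => ?_
    have hp := (h a p hc hd).2
    -- The shell is invariant under (a, p) ↦ (-a, -p), so the part even in p can be isolated.
    have hm := (h (-a) (-p) (by rw [← neg_one_smul ℝ p, curlOf_smul, hc]; module)
      (by rw [← neg_one_smul ℝ p, divOf_smul, hd, mul_zero])).2
    have h0 := hN.2
    simp only [pointProlong, divOf, Fin.sum_univ_three, Pi.neg_apply] at hp hm h0 ⊢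
    linear_combination h0 - (1 / 2) * hp - (1 / 2) * hm
  subst hM
  obtain ⟨⟨b₀, hb₀⟩, hd₀⟩ := hN
  have hsplit : ∀ p, pointProlong N H K 0 p =
      N + fun k i => ∑ l, H k l * p l i - ∑ m, p k m * K m i := fun p => by
    ext k i
    simp [pointProlong]
    ring
  have hlin : ∀ (a : ℝ) (p : Fin 3 → Fin 3 → ℝ), curlOf p = a • B → divOf p = 0 →
      (∃ b : ℝ, curlOf (fun k i => ∑ l, H k l * p l i - ∑ m, p k m * K m i) = a • η + b • B) ∧
      divOf (fun k i => ∑ l, H k l * p l i - ∑ m, p k m * K m i) = 0 := by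
    intro a p hc hd
    obtain ⟨⟨b, hb⟩, hd'⟩ := h a p hc hd
    rw [hsplit, curlOf_add, hb₀] at hb
    rw [hsplit, divOf_add, hd₀, zero_add] at hd'
    refine ⟨⟨b - b₀, ?_⟩, hd'⟩
    rw [← sub_eq_zero] at hb ⊢
    refine Eq.trans ?_ hb
    module
  obtain ⟨κ, t, v, rfl, rfl⟩ := conformal_of_curl_parallel (H := H) (K := K) (B := B)
    (fun a p hc hd => (hlin a p hc hd).2) fun s => by
      obtain ⟨b, hb⟩ := (hlin 0 (symMat s) (by rw [curlOf_symMat, zero_smul]) (divOf_symMat s)).1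
      exact ⟨b, by rw [hb, zero_smul, zero_add]⟩
  refine ⟨rfl, ⟨⟨b₀, hb₀⟩, hd₀⟩, κ, t, ?_⟩
  -- Here α = 2 enters with η, and the curl equals 2 v × B + 2(t - κ)B; solving for η gives the
  -- value of c below.
  obtain ⟨b, hb⟩ := (hlin 2 (crossMat B) hcross (divOf_crossMat B)).1
  refine ⟨t - κ - b / 2, v, rfl, rfl, ?_⟩
  have e0 := congrFun hb 0
  have e1 := congrFun hb 1
  have e2 := congrFun hb 2
  simp [curlOf, crossMat, similarityMat, Fin.sum_univ_three] at e0 e1 e2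
  ext k
  fin_cases k <;> simp [similarityMat, Fin.sum_univ_three] <;> linarith

/-! ### Point fields: integration over x and B. -/

theorem clm_apply_eq_sum {W : Type*} [NormedAddCommGroup W] [NormedSpace ℝ W] (T : Vec3 →L[ℝ] W)
    (u : Vec3) : T u = ∑ i, u i • T (Pi.single i 1) := by
  conv_lhs => rw [← Finset.univ_sum_single u, map_sum]
  refine Finset.sum_congr rfl fun i _ => ?_
  rw [← map_smul, ← Pi.single_smul, smul_eq_mul, mul_one]

/-- The entries of `similarityMat` that are symmetric in the lower indices, as those of a second
derivative, vanish when the rotation part varies only along its own axes. -/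
theorem secondDerivative_eq_zero {s : Fin 3 → Fin 3 → Vec3} (hs : ∀ i j, s i j = s j i)
    {t : Vec3} {w : Fin 3 → Vec3} (hsw : ∀ j i m, s j i m = similarityMat (t j) (fun l => w l j) m i)
    (hw : ∀ i j, i ≠ j → w i j = 0) : s = 0 := by
  have h : ∀ i j m, similarityMat (t j) (fun l => w l j) m i =
      similarityMat (t i) (fun l => w l i) m j := fun i j m => by
    rw [← hsw, ← hsw, hs]
  have w01 := hw 0 1 (by decide)
  have w02 := hw 0 2 (by decide)
  have w10 := hw 1 0 (by decide)
  have w12 := hw 1 2 (by decide)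
  have w20 := hw 2 0 (by decide)
  have w21 := hw 2 1 (by decide)
  have a0 := h 0 1 0
  have a1 := h 0 1 1
  have a2 := h 0 1 2
  have b0 := h 1 2 0
  have b1 := h 1 2 1
  have c1 := h 0 2 1
  simp [similarityMat, w01, w02, w10, w12, w20, w21] at a0 a1 a2 b0 b1 c1
  have ww : ∀ i j, w i j = 0 := fun i j => by
    fin_cases i <;> fin_cases j <;> simp [w01, w02, w10, w12, w20, w21] <;> linarith
  have tt : ∀ j, t j = 0 := fun j => by fin_cases j <;> simp <;> linarith
  ext j i m
  rw [hsw]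
  simp only [ww, tt]
  fin_cases i <;> fin_cases m <;> simp [similarityMat]

/-- No differentiability of t or v is needed: every entry is t or a coordinate of v up to sign. -/
theorem fderiv_similarityMat {U : Set Vec3} (hU : IsOpen U) {E : Vec3 → ℝ} {t : Vec3 → ℝ}
    {v : Vec3 → Vec3} {m i : Fin 3} (hE : ∀ x ∈ U, E x = similarityMat (t x) (v x) m i) {x : Vec3}
    (hx : x ∈ U) (u : Vec3) :
    fderiv ℝ E x u =
      similarityMat (fderiv ℝ t x u) (fun l => fderiv ℝ (fun y => v y l) x u) m i := by
  have : E =ᶠ[nhds x] fun y => similarityMat (t y) (v y) m i :=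
    Filter.eventually_of_mem (hU.mem_nhds hx) hE
  rw [this.fderiv_eq]
  fin_cases m <;> fin_cases i <;> simp [similarityMat, fderiv_fun_neg]

/-- Symmetry of second derivatives, with `hv`, kills the second derivative of f, so f is affine on
the connected set U. Without `hv` the special conformal maps would survive. The lemma serves for η
as a function of B and for ξ as a function of x. -/
theorem exists_eq_similarity {U : Set Vec3} (hU : IsOpen U) (hc : IsPreconnected U)
    {f : Vec3 → Vec3} (hf : ContDiffOn ℝ ∞ f U) {t : Vec3 → ℝ} {v : Vec3 → Vec3}
    (hd : ∀ x ∈ U, ∀ i m, fderiv ℝ f x (Pi.single i 1) m = similarityMat (t x) (v x) m i)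
    (hv : ∀ x ∈ U, ∀ i j, i ≠ j → fderiv ℝ (fun y => v y i) x (Pi.single j 1) = 0) :
    ∃ (l : Vec3) (t₀ : ℝ) (v₀ : Vec3), ∀ x ∈ U,
      f x = (fun k => l k + ∑ m, similarityMat t₀ v₀ k m * x m) ∧ t x = t₀ ∧ v x = v₀ := by
  have hF : ContDiffOn ℝ ∞ (fderiv ℝ f) U := hf.fderiv_of_isOpen hU (by simp)
  have hFd : ∀ x ∈ U, DifferentiableAt ℝ (fderiv ℝ f) x := fun x hx =>
    (hF.contDiffAt (hU.mem_nhds hx)).differentiableAt (by simp)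
  have hfd : DifferentiableOn ℝ f U := hf.differentiableOn (by simp)
  have hF0 : U.EqOn (fderiv ℝ (fderiv ℝ f)) 0 := by
    intro x hx
    have hsymm : IsSymmSndFDerivAt ℝ f x :=
      (hf.contDiffAt (hU.mem_nhds hx)).isSymmSndFDerivAt (by
        rw [minSmoothness_of_isRCLikeNormedField]
        exact WithTop.coe_le_coe.2 (le_top : (2 : ℕ∞) ≤ ⊤))
    have hz := secondDerivative_eq_zero
      (s := fun j i => fderiv ℝ (fderiv ℝ f) x (Pi.single j 1) (Pi.single i 1))
      (t := fun j => fderiv ℝ t x (Pi.single j 1))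
      (w := fun l j => fderiv ℝ (fun y => v y l) x (Pi.single j 1))
      (fun i j => hsymm _ _) (fun j i m => by
        rw [← fderiv_similarityMat hU (E := fun y => fderiv ℝ f y (Pi.single i 1) m)
          (fun y hy => hd y hy i m) hx]
        have := hasFDerivAt_pi'.1
          ((hFd x hx).hasFDerivAt.clm_apply (hasFDerivAt_const (Pi.single i (1 : ℝ)) x)) m
        rw [this.fderiv]
        simp) (hv x hx)
    refine ContinuousLinearMap.ext fun u => ContinuousLinearMap.ext fun u' => ?_
    rw [clm_apply_eq_sum _ u, sum_apply]
    simp only [smul_apply]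
    refine Finset.sum_eq_zero fun j _ => ?_
    rw [clm_apply_eq_sum _ u']
    rw [Finset.sum_eq_zero fun i _ => by
      rw [show fderiv ℝ (fderiv ℝ f) x (Pi.single j 1) (Pi.single i 1) = 0 from
        congrFun (congrFun hz j) i, smul_zero], smul_zero]
  obtain ⟨T, hT⟩ := hU.exists_is_const_of_fderiv_eq_zero hc
    (fun x hx => (hFd x hx).differentiableWithinAt) hF0
  obtain ⟨l, hl⟩ := hU.exists_eq_add_of_fderiv_eq hc hfd (g := T)
    T.differentiable.differentiableOn fun x hx => by rw [hT x hx, T.fderiv]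
  obtain rfl | ⟨x₀, hx₀⟩ := U.eq_empty_or_nonempty
  · exact ⟨0, 0, 0, by simp⟩
  have hTe : ∀ x ∈ U, ∀ i m, T (Pi.single i 1) m = similarityMat (t x) (v x) m i := fun x hx i m => by
    rw [← hT x hx, hd x hx]
  refine ⟨l, t x₀, v x₀, fun x hx => ⟨?_, ?_, ?_⟩⟩
  · rw [hl hx]
    ext k
    change (T x + l) k = _
    rw [Pi.add_apply, clm_apply_eq_sum T, Finset.sum_apply, add_comm]
    congr 1
    refine Finset.sum_congr rfl fun m _ => ?_
    rw [Pi.smul_apply, hTe x₀ hx₀, smul_eq_mul, mul_comm]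
  · have h := (hTe x hx 0 0).symm.trans (hTe x₀ hx₀ 0 0)
    simpa [similarityMat] using h
  · have h0 := (hTe x hx 1 2).symm.trans (hTe x₀ hx₀ 1 2)
    have h1 := (hTe x hx 2 0).symm.trans (hTe x₀ hx₀ 2 0)
    have h2 := (hTe x hx 0 1).symm.trans (hTe x₀ hx₀ 0 1)
    ext i
    fin_cases i
    · simpa [similarityMat] using h0
    · simpa [similarityMat] using h1
    · simpa [similarityMat] using h2

/-- The condition that the `x`-derivatives of `B ↦ t(x) B + v(x) × B` have to satisfy. -/
theorem gradient_eq_zero {a : Vec3} {w : Fin 3 → Vec3}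
    (h : ∀ l : Fin 3, (∃ b : ℝ, curlOf (fun k i => similarityMat (a i) (fun m => w m i) k l) =
        b • (Pi.single l 1 : Vec3)) ∧
      divOf (fun k i => similarityMat (a i) (fun m => w m i) k l) = 0) :
    a = 0 ∧ ∀ i j, i ≠ j → w i j = 0 := by
  obtain ⟨⟨b0, c0⟩, d0⟩ := h 0
  obtain ⟨⟨b1, c1⟩, d1⟩ := h 1
  obtain ⟨⟨b2, c2⟩, d2⟩ := h 2
  have c01 := congrFun c0 1
  have c02 := congrFun c0 2
  have c10 := congrFun c1 0
  have c12 := congrFun c1 2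
  have c20 := congrFun c2 0
  have c21 := congrFun c2 1
  simp [curlOf, divOf, similarityMat, Fin.sum_univ_three] at d0 d1 d2 c01 c02 c10 c12 c20 c21
  refine ⟨?_, ?_⟩
  · ext i
    fin_cases i <;> simp <;> linarith
  · intro i j hij
    fin_cases i <;> fin_cases j <;> simp at hij ⊢ <;> linarith

theorem PointField.fderiv_toGenerator {V : PointField} {z : Jet1}
    (hV : DifferentiableAt ℝ V (z.1, z.2.1)) (v : Jet1) :
    fderiv ℝ V.toGenerator z v = fderiv ℝ V (z.1, z.2.1) (v.1, v.2.1) := by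
  let T : Jet1 →L[ℝ] Vec3 × Vec3 := (ContinuousLinearMap.fst ℝ Vec3 _).prod
    ((ContinuousLinearMap.fst ℝ Vec3 _).comp (ContinuousLinearMap.snd ℝ Vec3 _))
  have h : HasFDerivAt V.toGenerator ((fderiv ℝ V (z.1, z.2.1)).comp T) z :=
    HasFDerivAt.comp z (g := V) (f := fun y : Jet1 => (y.1, y.2.1)) hV.hasFDerivAt T.hasFDerivAt
  rw [h.fderiv]
  rfl

/-- The derivatives of a point field with respect to `x`, as two matrices, for `ξ` and `η`. -/
noncomputable def PointField.jacobianX (V : PointField) (q : Vec3 × Vec3) :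
    (Fin 3 → Fin 3 → ℝ) × (Fin 3 → Fin 3 → ℝ) :=
  (fun m i => (fderiv ℝ V q (Pi.single i 1, 0)).1 m,
    fun m i => (fderiv ℝ V q (Pi.single i 1, 0)).2 m)

/-- The derivatives of a point field with respect to `B`, as two matrices, for `ξ` and `η`. -/
noncomputable def PointField.jacobianB (V : PointField) (q : Vec3 × Vec3) :
    (Fin 3 → Fin 3 → ℝ) × (Fin 3 → Fin 3 → ℝ) :=
  (fun m i => (fderiv ℝ V q (0, Pi.single i 1)).1 m,
    fun m i => (fderiv ℝ V q (0, Pi.single i 1)).2 m)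

theorem PointField.prolongCoeff_toGenerator {V : PointField} {z : Jet1}
    (hV : DifferentiableAt ℝ V (z.1, z.2.1)) (w : Fin 3 → Fin 3 → Fin 3 → ℝ) :
    prolongCoeff V.toGenerator z w =
      pointProlong (V.jacobianX (z.1, z.2.1)).2 (V.jacobianB (z.1, z.2.1)).2
        (V.jacobianX (z.1, z.2.1)).1 (V.jacobianB (z.1, z.2.1)).1 z.2.2 := by
  have hdir : ∀ i, fderiv ℝ V.toGenerator z (totalDir z w i) =
      fderiv ℝ V (z.1, z.2.1) (Pi.single i 1, 0) +
        ∑ l, z.2.2 l i • fderiv ℝ V (z.1, z.2.1) (0, Pi.single l 1) := fun i => by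
    rw [fderiv_toGenerator hV]
    have h := clm_apply_eq_sum ((fderiv ℝ V (z.1, z.2.1)).comp (ContinuousLinearMap.inr ℝ Vec3 Vec3))
      fun l => z.2.2 l i
    simp only [ContinuousLinearMap.comp_apply, ContinuousLinearMap.inr_apply] at h
    rw [← h, ← map_add]
    simp [totalDir]
  ext k i
  simp only [prolongCoeff, hdir, pointProlong, jacobianX, jacobianB]
  simp [Fin.sum_univ_three]
  ring

theorem isOpen_pairsOver {D : Set Vec3} (hD : IsOpen D) :
    IsOpen {q : Vec3 × Vec3 | q.1 ∈ D ∧ q.2 ≠ 0} :=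
  (hD.preimage continuous_fst).inter (isOpen_ne.preimage continuous_snd)

theorem PointField.consequences_of_admits {D : Set Vec3} (hD : IsOpen D) {V : PointField}
    (hV : ContDiffOn ℝ ∞ V {q | q.1 ∈ D ∧ q.2 ≠ 0})
    (hVa : AdmitsModConsequences (jetsOver D) V.toGenerator) {x B : Vec3} (hx : x ∈ D)
    (hB : B ≠ 0) :
    (V.jacobianB (x, B)).1 = 0 ∧
      ((∃ b : ℝ, curlOf (V.jacobianX (x, B)).2 = b • B) ∧ divOf (V.jacobianX (x, B)).2 = 0) ∧
      ∃ (κ t c : ℝ) (v : Vec3), (V.jacobianX (x, B)).1 = similarityMat κ v ∧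
        (V.jacobianB (x, B)).2 = similarityMat t v ∧
        (V (x, B)).2 = fun k => ∑ l, similarityMat c v k l * B l := by
  refine pointProlong_consequences hB fun a p hc hd => ?_
  have ha : forceFreeLHS (a, x, B, p) = 0 := (forceFreeLHS_eq_zero_iff _ _ _ _).2 ⟨hc, hd⟩
  obtain ⟨w, hw, hwc⟩ := exists_symmetric_of_curl (fun i => a • fun k => p k i) (by
    simp only [Pi.smul_apply, smul_eq_mul, ← Finset.mul_sum]
    rw [show ∑ i, p i i = 0 from hd, mul_zero])
  have hda : ∀ j, fderiv ℝ forceFreeLHS (a, x, B, p)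
      ((0 : Vec3) j, totalDir (x, B, p) w j) = 0 := fun j => by
    refine (forceFreeLHS_consequence_iff _ _ _ _ _ _).2 ⟨?_, (hwc j).2⟩
    rw [(hwc j).1]
    simp
  obtain ⟨b, hb⟩ := hVa (x, B, p) ⟨hx, hB⟩ w hw a 0 ha hda
  have hdiff : DifferentiableAt ℝ V (x, B) :=
    (hV.contDiffAt ((isOpen_pairsOver hD).mem_nhds ⟨hx, hB⟩)).differentiableAt (by simp)
  rw [prolongedAction_eq_zero_iff, prolongCoeff_toGenerator (z := (x, B, p)) hdiff] at hb
  exact ⟨⟨b, hb.1⟩, hb.2⟩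

theorem isPreconnected_compl_zero : IsPreconnected ({0}ᶜ : Set Vec3) :=
  (isConnected_compl_singleton_of_one_lt_rank (by simp) 0).isPreconnected

/-- The axial vector of the antisymmetric part, for a matrix `similarityMat t v`. -/
def rotationPart (A : Fin 3 → Fin 3 → ℝ) : Vec3 := ![A 2 1, A 0 2, A 1 0]

theorem rotationPart_similarityMat (t : ℝ) (v : Vec3) : rotationPart (similarityMat t v) = v := by
  ext i; fin_cases i <;> simp [rotationPart, similarityMat]

theorem PointField.eq_forceFreeOperator {D : Set Vec3} (hD : IsOpen D) (hDc : IsPreconnected D)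
    {V : PointField} (hV : ContDiffOn ℝ ∞ V {q | q.1 ∈ D ∧ q.2 ≠ 0})
    (hVa : AdmitsModConsequences (jetsOver D) V.toGenerator) :
    ∃ (l : Vec3) (R α δ γ μ : ℝ), ∀ x ∈ D, ∀ B ≠ 0,
      V (x, B) = forceFreeOperator l R α δ γ μ (x, B) := by
  have hcons := fun x hx B hB => consequences_of_admits hD hV hVa (x := x) (B := B) hx hB
  have hdiff : ∀ x ∈ D, ∀ B ≠ 0, DifferentiableAt ℝ V (x, B) := fun x hx B hB =>
    (hV.contDiffAt ((isOpen_pairsOver hD).mem_nhds ⟨hx, hB⟩)).differentiableAt (by simp)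
  have hslB : ∀ x ∈ D, ∀ B ≠ 0, HasFDerivAt (fun B => V (x, B))
      ((fderiv ℝ V (x, B)).comp (ContinuousLinearMap.inr ℝ Vec3 Vec3)) B := fun x hx B hB =>
    (hdiff x hx B hB).hasFDerivAt.comp B (hasFDerivAt_prodMk_right x B)
  have hslx : ∀ x ∈ D, ∀ B ≠ 0, HasFDerivAt (fun x => V (x, B))
      ((fderiv ℝ V (x, B)).comp (ContinuousLinearMap.inl ℝ Vec3 Vec3)) x := fun x hx B hB =>
    (hdiff x hx B hB).hasFDerivAt.comp x (hasFDerivAt_prodMk_left x B)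
  have hsx : ∀ B ≠ 0, ContDiffOn ℝ ∞ (fun x => V (x, B)) D := fun B hB =>
    hV.comp (contDiff_id.prodMk contDiff_const).contDiffOn fun x hx => ⟨hx, hB⟩
  have hsB : ∀ x ∈ D, ContDiffOn ℝ ∞ (fun B => V (x, B)) {0}ᶜ := fun x hx =>
    hV.comp (contDiff_const.prodMk contDiff_id).contDiffOn fun B hB => ⟨hx, hB⟩
  have hopen : IsOpen ({0}ᶜ : Set Vec3) := isOpen_compl_singleton
  have he : ∀ i : Fin 3, (Pi.single i 1 : Vec3) ≠ 0 := fun i => by simp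
  have hξ : ∀ x ∈ D, ∀ B ≠ 0, (V (x, B)).1 = (V (x, Pi.single 0 1)).1 := by
    intro x hx B hB
    refine hopen.is_const_of_fderiv_eq_zero isPreconnected_compl_zero (𝕜 := ℝ)
      (f := fun B => (V (x, B)).1) ((hsB x hx).fst.differentiableOn (by simp)) ?_ hB (he 0)
    intro B' hB'
    rw [(hslB x hx B' hB').fst.fderiv]
    refine ContinuousLinearMap.ext fun u => ?_
    rw [clm_apply_eq_sum]
    refine Finset.sum_eq_zero fun i _ => ?_
    have : (fderiv ℝ V (x, B') (0, Pi.single i 1)).1 = 0 := by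
      ext m
      exact congrFun (congrFun (hcons x hx B' hB').1 m) i
    simp [this]
  have hK : ∀ x ∈ D, ∀ B ≠ 0, (V.jacobianX (x, B)).1 = (V.jacobianX (x, Pi.single 0 1)).1 := by
    intro x hx B hB
    have h1 := (hslx x hx B hB).fst.fderiv
    have h2 := (hslx x hx _ (he 0)).fst.fderiv
    have h3 : (fun y => (V (y, B)).1) =ᶠ[nhds x] fun y => (V (y, Pi.single 0 1)).1 :=
      Filter.eventually_of_mem (hD.mem_nhds hx) fun y hy => hξ y hy B hB
    ext m i
    have h4 := h1.symm.trans (h3.fderiv_eq.trans h2)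
    exact congrFun (congrArg (fun T : Vec3 →L[ℝ] Vec3 => T (Pi.single i 1)) h4) m
  let κ : Vec3 → ℝ := fun x => (V.jacobianX (x, Pi.single 0 1)).1 0 0
  let v : Vec3 → Vec3 := fun x => rotationPart (V.jacobianX (x, Pi.single 0 1)).1
  have hloc : ∀ x ∈ D, ∀ B ≠ 0, (V.jacobianX (x, B)).1 = similarityMat (κ x) (v x) ∧
      (V.jacobianB (x, B)).2 = similarityMat ((V.jacobianB (x, B)).2 0 0) (v x) ∧
      ∃ c : ℝ, (V (x, B)).2 = fun k => ∑ l, similarityMat c (v x) k l * B l := by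
    intro x hx B hB
    obtain ⟨-, -, κ₁, t₁, c₁, v₁, h1, h2, h3⟩ := hcons x hx B hB
    have hv : v x = v₁ := by
      simp only [v, ← hK x hx B hB, h1, rotationPart_similarityMat]
    have hκ : κ x = κ₁ := by
      simp only [κ, ← hK x hx B hB, h1]
      simp [similarityMat]
    refine ⟨by rw [h1, hv, hκ], ?_, c₁, by rw [h3, hv]⟩
    rw [h2, hv]
    simp [similarityMat]
  let t : Vec3 → ℝ := fun x => (V (x, Pi.single 0 1)).2 0
  have hη : ∀ x ∈ D, ∀ B ≠ 0,
      (V (x, B)).2 = fun k => ∑ l, similarityMat (t x) (v x) k l * B l := by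
    intro x hx
    -- As a function of B, the rotation vector is constant, being that of ∂ξ/∂x, where ξ does not
    -- involve B. So η is affine in B.
    obtain ⟨l, t₀, v₀, h⟩ := exists_eq_similarity hopen isPreconnected_compl_zero (hsB x hx).snd
      (t := fun B => (V.jacobianB (x, B)).2 0 0) (v := fun _ => v x) (fun B hB i m => by
        rw [← (hloc x hx B hB).2.1, (hslB x hx B hB).snd.fderiv]
        rfl) (fun B hB i j hij => by simp)
    have hv : v x = v₀ := (h _ (he 0)).2.2
    -- Comparison with η = cB + v × B makes the constant term parallel to every B, hence zero.
    have hl : ∀ B : Vec3, B ≠ 0 → ∃ c : ℝ, ∀ k, l k = c * B k := by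
      intro B hB
      obtain ⟨-, -, c, hc⟩ := hloc x hx B hB
      refine ⟨c - t₀, fun k => ?_⟩
      have h1 := congrFun ((h B hB).1.symm.trans hc) k
      rw [← hv] at h1
      fin_cases k <;> simp [similarityMat, Fin.sum_univ_three] at h1 ⊢ <;> linarith
    have hl0 : l = 0 := by
      obtain ⟨c, h0⟩ := hl _ (he 0)
      obtain ⟨c', h1⟩ := hl _ (he 1)
      ext k
      fin_cases k
      · simpa using h1 0
      · simpa using h0 1
      · simpa using h0 2
    have ht : t x = t₀ := by
      have := congrFun (h _ (he 0)).1 0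
      simpa [t, hl0, similarityMat, Fin.sum_univ_three] using this
    intro B hB
    rw [(h B hB).1, hl0, ht, hv]
    simp
  have hgrad : ∀ x ∈ D, (fun i => fderiv ℝ t x (Pi.single i 1)) = (0 : Vec3) ∧
      ∀ i j, i ≠ j → fderiv ℝ (fun y => v y i) x (Pi.single j 1) = 0 := by
    intro x hx
    refine gradient_eq_zero (w := fun m i => fderiv ℝ (fun y => v y m) x (Pi.single i 1))
      fun l => ?_
    have hN : (V.jacobianX (x, Pi.single l 1)).2 = fun k i =>
        similarityMat (fderiv ℝ t x (Pi.single i 1))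
          (fun m => fderiv ℝ (fun y => v y m) x (Pi.single i 1)) k l := by
      ext k i
      rw [← fderiv_similarityMat hD (E := fun y => (V (y, Pi.single l 1)).2 k)
        (fun y hy => by
          rw [hη y hy _ (he l)]
          simp [Pi.single_apply]) hx,
        (hasFDerivAt_pi'.1 (hslx x hx _ (he l)).snd k).fderiv]
      rfl
    have h := (hcons x hx _ (he l)).2.1
    rwa [hN] at h
  obtain ⟨l, κ₀, v₀, hsim⟩ := exists_eq_similarity hD hDc (hsx _ (he 0)).fst (t := κ) (v := v)
    (fun x hx i m => by
      rw [← (hloc x hx _ (he 0)).1, (hslx x hx _ (he 0)).fst.fderiv]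
      rfl) fun x hx => (hgrad x hx).2
  obtain ⟨t₀, ht⟩ := hD.exists_is_const_of_fderiv_eq_zero hDc (𝕜 := ℝ) (f := t)
    ((contDiffOn_pi.1 (hsx _ (he 0)).snd 0).differentiableOn (by simp)) fun x hx => by
      refine ContinuousLinearMap.ext fun u => ?_
      rw [clm_apply_eq_sum]
      refine Finset.sum_eq_zero fun i _ => ?_
      rw [show fderiv ℝ t x (Pi.single i 1) = 0 from congrFun (hgrad x hx).1 i, smul_zero]
  -- The signs translate v × · into the orientations chosen for the three rotations.
  refine ⟨l, κ₀, t₀, -v₀ 2, v₀ 1, -v₀ 0, fun x hx B hB => ?_⟩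
  rw [forceFreeOperator_apply]
  refine Prod.ext ?_ ?_
  · rw [hξ x hx B hB, (hsim x hx).1]
    ext k
    fin_cases k <;> simp [similarityMat, Fin.sum_univ_three] <;> ring
  · rw [hη x hx B hB, ht x hx, (hsim x hx).2.2]
    ext k
    fin_cases k <;> simp [similarityMat, Fin.sum_univ_three] <;> ring

/-! ### Unrestricted second derivatives: removing trivial operators. -/

/-- Since Λ kills symmetric trace-free matrices, it takes one value λ on the three diagonal matrix
units. Pure second derivatives ∂²Bᵏ/∂(xᵏ)² violate the differentiated divergence equation; testing
with them gives eₖ × λ ∥ B for every k, hence λ = 0, and the divergence λₖ + ξₖ = 0 finishes. -/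
theorem eq_zero_of_unrestricted {Λ : (Fin 3 → Fin 3 → ℝ) →ₗ[ℝ] Vec3} {B ξ : Vec3}
    (hΛ : ∀ s, Λ (symMat s) = 0)
    (h : ∀ w, IsSecondJet w →
      (∃ b : ℝ, curlOf (fun k i => Λ (fun k j => w k i j) k + ∑ m, w k i m * ξ m) = b • B) ∧
        divOf (fun k i => Λ (fun k j => w k i j) k + ∑ m, w k i m * ξ m) = 0) :
    ξ = 0 := by
  obtain ⟨L, hL⟩ : ∃ L : Fin 3 → Fin 3 → Vec3, ∀ m k, Λ m k = ∑ a, ∑ b, m a b * L a b k := by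
    refine ⟨fun a b => Λ (Pi.single a (Pi.single b 1)), fun m k => ?_⟩
    have hm : m = ∑ a, ∑ b, m a b • Pi.single a (Pi.single b 1) := by
      ext i j
      simp only [Finset.sum_apply, Pi.smul_apply, smul_eq_mul]
      fin_cases i <;> fin_cases j <;> simp [Fin.sum_univ_three]
    conv_lhs => rw [hm]
    simp only [map_sum, map_smul, Finset.sum_apply, Pi.smul_apply, smul_eq_mul]
  have hsym : ∀ s k, ∑ a, ∑ b, symMat s a b * L a b k = 0 := fun s k => by
    rw [← hL, hΛ]
    rfl
  have s0 := hsym ![1, 0, 0, 0, 0]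
  have s1 := hsym ![0, 1, 0, 0, 0]
  simp [symMat, Fin.sum_univ_three] at s0 s1
  have l0 : ∀ k, L 0 0 k = L 2 2 k := fun k => by linarith [s0 k]
  have l1 : ∀ k, L 1 1 k = L 2 2 k := fun k => by linarith [s1 k]
  obtain ⟨⟨b0, c0⟩, d0⟩ := h ![![![1, 0, 0], 0, 0], 0, 0] (by
    simp [IsSecondJet, Fin.forall_fin_succ])
  obtain ⟨⟨b1, c1⟩, d1⟩ := h ![0, ![0, ![0, 1, 0], 0], 0] (by
    simp [IsSecondJet, Fin.forall_fin_succ])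
  obtain ⟨⟨b2, c2⟩, d2⟩ := h ![0, 0, ![0, 0, ![0, 0, 1]]] (by
    simp [IsSecondJet, Fin.forall_fin_succ])
  have e01 := mul_eq_mul_of_eq_smul c0 c1 0 1
  have e02 := mul_eq_mul_of_eq_smul c0 c2 0 2
  have e12 := mul_eq_mul_of_eq_smul c1 c2 1 2
  simp only [hL] at e01 e02 e12 d0 d1 d2
  simp [curlOf, divOf, Fin.sum_univ_three, l0, l1] at e01 e02 e12 d0 d1 d2
  ext k
  fin_cases k <;> simp <;> linarith

/-- The derivative of the difference of characteristics vanishes along the shell but not necessarily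
across it; this transversal part is Λ. Subtracting the equations at w = 0 leaves the part linear in
w, to which `eq_zero_of_unrestricted` applies. -/
theorem Admits.eq_of_characteristic_eq {D : Set Vec3} (hD : IsOpen D) {X Y : Generator}
    (hX : ContDiffOn ℝ ∞ X (jetsOver D)) (hY : ContDiffOn ℝ ∞ Y (jetsOver D))
    (hXa : Admits (jetsOver D) X) (hYa : Admits (jetsOver D) Y)
    (h : ∀ z ∈ jetsOver D, OnShell z → characteristic X z = characteristic Y z)
    {z : Jet1} (hz : z ∈ jetsOver D) (hon : OnShell z) : X z = Y z := by
  have hQ := h z hz hon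
  obtain ⟨a, ha⟩ := hon
  have hXd := differentiableAt_of_contDiffOn_jetsOver hD hX hz
  have hYd := differentiableAt_of_contDiffOn_jetsOver hD hY hz
  let T : Jet1 →L[ℝ] Vec3 :=
    fderiv ℝ (characteristic X) z - fderiv ℝ (characteristic Y) z
  let Λ : (Fin 3 → Fin 3 → ℝ) →ₗ[ℝ] Vec3 :=
    { toFun := fun m => T (0, 0, m)
      map_add' := fun m n => by rw [← map_add]; simp
      map_smul' := fun c m => by rw [RingHom.id_apply, ← map_smul]; simp }
  have hη : (X z).2 - (Y z).2 = fun k => ∑ m, z.2.2 k m * ((X z).1 - (Y z).1) m := by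
    ext k
    have := congrFun hQ k
    simp only [characteristic, Fin.sum_univ_three] at this
    simp only [Pi.sub_apply, Fin.sum_univ_three]
    linear_combination this
  have hξ : (X z).1 - (Y z).1 = 0 := by
    refine eq_zero_of_unrestricted (Λ := Λ) (B := z.2.1) (fun s => ?_) fun w hw => ?_
    · have hv : fderiv ℝ forceFreeLHS (a, z) (0, 0, 0, symMat s) = 0 :=
        (forceFreeLHS_consequence_iff _ _ _ _ _ _).2
          ⟨by rw [curlOf_symMat]; simp, divOf_symMat s⟩
      change fderiv ℝ (characteristic X) z (0, 0, symMat s) -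
        fderiv ℝ (characteristic Y) z (0, 0, symMat s) = 0
      rw [fderiv_characteristic_eq hD hX hY h hz ha hv, sub_self]
    · have hdiff : ∀ w, IsSecondJet w →
          (∃ b : ℝ, curlOf (prolongCoeff X z w - prolongCoeff Y z w) =
            a • ((X z).2 - (Y z).2) + b • z.2.1) ∧
          divOf (prolongCoeff X z w - prolongCoeff Y z w) = 0 := by
        intro w hw
        obtain ⟨b, hb⟩ := hXa z hz w hw a ha
        obtain ⟨b', hb'⟩ := hYa z hz w hw a ha
        rw [prolongedAction_eq_zero_iff] at hb hb'
        have hs : prolongCoeff X z w - prolongCoeff Y z w =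
            prolongCoeff X z w + (-1 : ℝ) • prolongCoeff Y z w := by module
        rw [hs, curlOf_add, curlOf_smul, divOf_add, divOf_smul, hb.1, hb.2, hb'.1, hb'.2]
        exact ⟨⟨b - b', by module⟩, by simp⟩
      obtain ⟨⟨b, hb⟩, hd⟩ := hdiff w hw
      obtain ⟨⟨b₀, hb₀⟩, hd₀⟩ := hdiff 0 fun k i j => rfl
      have hsplit : (fun k i => Λ (fun k j => w k i j) k + ∑ m, w k i m * ((X z).1 - (Y z).1) m) =
          (prolongCoeff X z w - prolongCoeff Y z w) +
            (-1 : ℝ) • (prolongCoeff X z 0 - prolongCoeff Y z 0) := by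
        ext k i
        have ht : totalDir z w i = totalDir z 0 i + (0, 0, fun k j => w k i j) := by
          simp only [totalDir, Prod.mk_add_mk, add_zero]
          congr 2
          ext k j
          simp
        simp only [Pi.add_apply, Pi.sub_apply, Pi.smul_apply, smul_eq_mul, prolongCoeff_eq hXd,
          prolongCoeff_eq hYd, ht, map_add]
        simp [Λ, T, Fin.sum_univ_three]
        ring
      rw [hsplit, curlOf_add, curlOf_smul, divOf_add, divOf_smul, hb, hd, hb₀, hd₀]
      exact ⟨⟨b - b₀, by module⟩, by simp⟩
  refine Prod.ext (sub_eq_zero.1 hξ) (sub_eq_zero.1 ?_)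
  rw [hη, hξ]
  ext k
  simp

theorem AdmitsModConsequences.exists_characteristic_eq_forceFreeOperator {D : Set Vec3}
    (hD : IsOpen D) (hDc : IsPreconnected D) {X : Generator}
    (hX : ContDiffOn ℝ ∞ X (jetsOver D)) (hXa : AdmitsModConsequences (jetsOver D) X) :
    ∃ (l : Vec3) (R α δ γ μ : ℝ), ∀ z ∈ jetsOver D, OnShell z →
      characteristic X z = characteristic (forceFreeOperator l R α δ γ μ).toGenerator z := by
  obtain ⟨V, hV, hXV⟩ := exists_pointField hD hX hXa
  have hVg : ContDiffOn ℝ ∞ V.toGenerator (jetsOver D) :=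
    hV.comp (contDiff_fst.prodMk contDiff_snd.fst).contDiffOn fun z hz => hz
  obtain ⟨l, R, α, δ, γ, μ, h⟩ := PointField.eq_forceFreeOperator hD hDc hV
    (admitsModConsequences_of_characteristic_eq hD hVg hX (fun z hz h => (hXV z hz h).symm) hXa)
  refine ⟨l, R, α, δ, γ, μ, fun z hz hon => ?_⟩
  rw [hXV z hz hon]
  exact congrArg (fun u : Vec3 × Vec3 => fun k => u.2 k - ∑ m, z.2.2 k m * u.1 m)
    (h z.1 hz.1 z.2.1 hz.2)

theorem mainTheorem4 :
    -- every operator of the family is admitted, on all jets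
    (∀ (l : Vec3) (R α δ γ μ : ℝ),
      Admits Set.univ (forceFreeOperator l R α δ γ μ).toGenerator) ∧
    -- every admitted operator is, on the system, one of the family
    (∀ D : Set Vec3, IsOpen D → IsConnected D →
      ∀ X : Generator, ContDiffOn ℝ ∞ X (jetsOver D) → Admits (jetsOver D) X →
        ∃ (l : Vec3) (R α δ γ μ : ℝ), ∀ z ∈ jetsOver D, OnShell z →
          X z = forceFreeOperator l R α δ γ μ (z.1, z.2.1)) ∧
    -- with differential consequences: the same family, up to operators with zero characteristic
    (∀ D : Set Vec3, IsOpen D → IsConnected D →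
      ∀ X : Generator, ContDiffOn ℝ ∞ X (jetsOver D) →
        (AdmitsModConsequences (jetsOver D) X ↔
          ∃ (l : Vec3) (R α δ γ μ : ℝ), ∀ z ∈ jetsOver D, OnShell z →
            characteristic X z =
              characteristic (forceFreeOperator l R α δ γ μ).toGenerator z)) ∧
    -- the family is that of the plasma equilibrium equations without the pressure terms
    (∀ (l : Vec3) (β R α δ γ μ : ℝ) (x B : Vec3) (P : ℝ),
      forceFreeOperator l R α δ γ μ (x, B) =
        ((plasmaOperator l β R α δ γ μ (x, B, P)).1,
          (plasmaOperator l β R α δ γ μ (x, B, P)).2.1)) := by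
  have hfam : ∀ (D : Set Vec3) (l : Vec3) (R α δ γ μ : ℝ),
      Admits (jetsOver D) (forceFreeOperator l R α δ γ μ).toGenerator :=
    fun D l R α δ γ μ z _ => admits_forceFreeOperator l R α δ γ μ z trivial
  refine ⟨admits_forceFreeOperator, fun D hD hDc X hX hXa => ?_, fun D hD hDc X hX => ⟨fun hXa =>
    hXa.exists_characteristic_eq_forceFreeOperator hD hDc.isPreconnected hX, ?_⟩,
    forceFreeOperator_eq_plasmaOperator⟩
  · obtain ⟨l, R, α, δ, γ, μ, h⟩ :=
      hXa.admitsModConsequences.exists_characteristic_eq_forceFreeOperator hD hDc.isPreconnected hX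
    exact ⟨l, R, α, δ, γ, μ, fun z hz hon => hXa.eq_of_characteristic_eq hD hX
      (contDiff_forceFreeOperator l R α δ γ μ).contDiffOn (hfam D l R α δ γ μ) h hz hon⟩
  · rintro ⟨l, R, α, δ, γ, μ, h⟩
    exact admitsModConsequences_of_characteristic_eq hD hX
      (contDiff_forceFreeOperator l R α δ γ μ).contDiffOn h
      (hfam D l R α δ γ μ).admitsModConsequences
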